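/- Notation on $\mathbb{C}$: $|z|_{\mathbb{C}}=|z|^2$, $\psi_{\mathbb{C}}(z)=e^{-2\pi i(z+\bar z)}$, $c_n(z)=(z/|z|)^n$ for $n\in\mathbb{Z}$, $dz=2\,dx\,dy$ (the self-dual Haar measure for $\psi_{\mathbb C}$) and $d^\times z=dz/|z|_{\mathbb{C}}$. The Mellin transform of $g$ at $|z|_{\mathbb C}^s c_n$ is $\mathcal{M}(g,s,n)=\int_{\mathbb{C}^\times} g(z)\,|z|_{\mathbb{C}}^{s}\,c_n(z)\,d^\times z$; it is well defined if this integral converges absolutely. For $\phi\in C_c^\infty(\mathbb{C}^\times)$ put $(\phi\star f)(z)=\int_{\mathbb{C}^\times}\phi(x)f(x^{-1}z)\,d^\times x$. A number $M$ is a weak Mellin transform of $f$ at $|z|_{\mathbb C}^s c_n$ if for every $\phi\in C_c^\infty(\mathbb{C}^\times)$ the convolution $\phi\star f$ is well defined, $\mathcal{M}(\phi\star f,s,n)$ is well defined, and $\mathcal{M}(\phi\star f,s,n)=M\,\mathcal{M}(\phi,s,n)$. Finally ${}_1F_1(u,v,z)=\sum_{k\ge 0}\frac{(u)_k}{(v)_k}\frac{z^k}{k!}$.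 **Proposition.** Let $a>0$ be real, $b\in\mathbb{C}$, $n\in\mathbb{Z}$, and $f(z)=\psi_{\mathbb{C}}(\tfrac a2|z|^2+bz)$, where $|z|$ is the usual modulus. Put $m=|n|$, and $\beta=\bar b$ if $n\ge 0$, $\beta=b$ if $n<0$. 1. For $\mathrm{Re}(s)>0$ the weak Mellin transform $Z_{a,b}(s,n)$ of $f$ at $|z|_{\mathbb{C}}^s c_n$ exists, is unique, and equals $$Z_{a,b}(s,n)=(-1)^m\,\frac{e^{-\frac{\pi i}{2}(s-\frac m2)}}{a^s}\,\frac{\Gamma(s+\frac m2)}{(2\pi)^{s-1}}\,\frac1{m!}\Big(\frac{\sqrt{2\pi}}{\sqrt a}\,\beta\Big)^m{}_1F_1\Big(s+\frac m2,\,1+m,\,\frac{2\pi i|b|^2}{a}\Big).$$ In particular $Z_{a,b}(s,0)=\frac{e^{-\frac{\pi i}{2}s}}{a^s}\frac{\Gamma(s)}{(2\pi)^{s-1}}\,{}_1F_1\big(s,1,\frac{2\pi i|b|^2}{a}\big)$. The right-hand side is meromorphic in $s\in\mathbb{C}$, so it is the meromorphic continuation of $Z_{a,b}(\cdot,n)$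 to $\mathbb{C}$. 2. If $n=0$ or $b\neq0$, then all zeros of $Z_{a,b}(\cdot,n)$, in $\mathrm{Re}(s)>0$ as well as of its meromorphic continuation to $\mathbb{C}$, lie on the line $\mathrm{Re}(s)=\tfrac12$. (If $n\ne0$ and $b=0$, then $Z_{a,b}(\cdot,n)$ is identically zero.) -/

import Mathlib

open Complex MeasureTheory
open scoped ContDiff ComplexConjugate

noncomputable section

namespace WeakMellin

/-- The normalized absolute value `|z|_ℂ = |z|²` of the locally compact field `ℂ`. -/
def absC (z : ℂ) : ℝ := ‖z‖ ^ 2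

/-- The standard additive character `ψ_ℂ(z) = exp(-2πi (z + z̄))` of `ℂ`. -/
def psiC (z : ℂ) : ℂ := Complex.exp (-2 * Real.pi * I * (z + conj z))

/-- The additive Haar measure `dz = 2 dx dy` of `ℂ`, the one which is self-dual with respect
to `psiC` (i.e. for which the Fourier inversion formula holds). -/
def addHaarC : Measure ℂ := (2 : ENNReal) • volume

/-- The multiplicative Haar measure `d^×z = dz / |z|_ℂ` of `ℂ^×`, as a measure on `ℂ`
(the point `0` is a null set). -/
def mulHaarC : Measure ℂ := addHaarC.withDensity fun z => ENNReal.ofReal (absC z)⁻¹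

/-- The character `c_n(z) = (z / |z|)^n` of `ℂ^×`, for `n ∈ ℤ`. -/
def unitChar (n : ℤ) (z : ℂ) : ℂ := (z / (‖z‖ : ℂ)) ^ n

/-- The integrand `f(z) |z|_ℂ^s c_n(z)` of the Mellin transform on `ℂ^×`. -/
def mellinIntegrand (f : ℂ → ℂ) (s : ℂ) (n : ℤ) (z : ℂ) : ℂ :=
  f z * (absC z : ℂ) ^ s * unitChar n z

/-- The Mellin transform (zeta integral) of `f` at `|z|_ℂ^s c_n(z)`. It is well defined if
`mellinIntegrand f s n` is integrable with respect to `d^×z`. -/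
def mellinC (f : ℂ → ℂ) (s : ℂ) (n : ℤ) : ℂ := ∫ z, mellinIntegrand f s n z ∂mulHaarC

/-- The test functions: smooth functions with compact support in `ℂ^×` (extended by `0`). -/
structure IsTestFunction (φ : ℂ → ℂ) : Prop where
  smooth : ContDiff ℝ ∞ φ
  compact : HasCompactSupport φ
  away : (0 : ℂ) ∉ tsupport φ

/-- The multiplicative convolution `(φ ⋆ f)(z) = ∫ φ(x) f(x⁻¹ z) d^×x`. -/
def mulConv (φ f : ℂ → ℂ) (z : ℂ) : ℂ := ∫ x, φ x * f (x⁻¹ * z) ∂mulHaarC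

/-- `M` is a weak Mellin transform of `f` at `|z|_ℂ^s c_n(z)`: for every test function `φ`, the
convolution `φ ⋆ f` is well defined on `ℂ^×`, its Mellin transform converges absolutely at
`|z|_ℂ^s c_n(z)`, and equals `M` times the Mellin transform of `φ`. -/
def IsWeakMellin (f : ℂ → ℂ) (s : ℂ) (n : ℤ) (M : ℂ) : Prop :=
  ∀ φ : ℂ → ℂ, IsTestFunction φ →
    (∀ z : ℂ, z ≠ 0 → Integrable (fun x => φ x * f (x⁻¹ * z)) mulHaarC) ∧
    Integrable (mellinIntegrand (mulConv φ f) s n) mulHaarC ∧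
    mellinC (mulConv φ f) s n = M * mellinC φ s n

/-- Kummer's confluent hypergeometric function `₁F₁(u, v, z) = ∑ (u)_k / (v)_k z^k / k!`. -/
def hyp1F1 (u v z : ℂ) : ℂ :=
  ∑' k : ℕ, (ascPochhammer ℂ k).eval u / (ascPochhammer ℂ k).eval v * (z ^ k / (k.factorial : ℂ))

/-- The second degree character `ψ_ℂ(½ a |z|² + b z)`, with `|z|` the usual modulus. -/
def gaussChar (a : ℝ) (b z : ℂ) : ℂ := psiC ((a : ℂ) / 2 * (‖z‖ : ℂ) ^ 2 + b * z)

/-- The expression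
`(-1)^m e^{-(πi/2)(s - m/2)} a^{-s} Γ(s + m/2) (2π)^{1-s} (1/m!) (√(2π/a) β)^m
  ₁F₁(s + m/2, 1 + m, 2πi |β|² / a)`. -/
def zExpr (a : ℝ) (β : ℂ) (m : ℕ) (s : ℂ) : ℂ :=
  (-1) ^ m * (Complex.exp (-(Real.pi * I / 2) * (s - m / 2)) / (a : ℂ) ^ s)
    * (Complex.Gamma (s + m / 2) / ((2 * Real.pi : ℝ) : ℂ) ^ (s - 1))
    * (1 / (m.factorial : ℂ))
    * (((Real.sqrt (2 * Real.pi) / Real.sqrt a : ℝ) : ℂ) * β) ^ m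
    * hyp1F1 (s + m / 2) (1 + m) (2 * Real.pi * I * (‖β‖ : ℂ) ^ 2 / a)

/-- The value `Z_{a,b}(s, n)`: `β = b̄` for `n ≥ 0`, and `β = b` for `n < 0`. -/
def zValue (a : ℝ) (b : ℂ) (n : ℤ) (s : ℂ) : ℂ :=
  zExpr a (if 0 ≤ n then conj b else b) n.natAbs s

end WeakMellin

end

/-!
Write `f = gaussChar a b`. Its Mellin integral does not converge absolutely, so `f` is approximated
by `gaussReg A b z = exp (-A |z|² - 2πi (b z + conj (b z)))` with `0 < Re A`; the character `f`
itself is the boundary case `A = 2πi a`.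

*The formula.* For `0 < Re A` everything converges absolutely. Expanding the two exponentials
`exp (-2πi b z)` and `exp (-2πi conj (b z))` in powers of `z` and `conj z`, rotation invariance kills
all terms but those on one diagonal, and these are Gamma integrals which add up to a Kummer series
(`mellinC_gaussReg`). By Fubini and the invariance of `d^×z`, the Mellin transform of
`φ ⋆ gaussReg A b` is the product of the Mellin transforms (`IsTestFunction.mellinC_mulConv`). Then
let `A → 2πi a`. The passage to the limit is dominated because `φ ⋆ gaussReg A b` decays faster than
any power of `|z|`, uniformly in `A` (`IsTestFunction.exists_oscInt_bound`): the Euler operator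
multiplies the oscillating factor by `2A |z/x|² + O(|z|)`, so integration by parts expresses `|z|²`
times such an integral through integrals of the same kind with coefficients `O(1 + |z|)`, which
gains one power of `|z|` at each step. Uniqueness only needs a test function whose Mellin transform
does not vanish at the given character.

*The zeros.* Let `n = 0` or `b ≠ 0`. The remaining factors, Gamma and elementary, have no zeros, so
all zeros are zeros of `₁F₁(u, v, i y)` with `u = s + m / 2`, `v = 1 + m` and `y ≥ 0` real. On the
imaginary axis Kummer's equation is a symmetric Sturm-Liouville problem up to the term
`Re u - v / 2`; integrating it from `0` to the zero forces `Re u = v / 2`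
(`re_eq_of_hyp1F1_eq_zero`), that is, `Re s = 1 / 2`.
-/

namespace WeakMellin

/-! ### Power series with factorially decaying coefficients -/

section PowerSeries

theorem summable_pow_div_factorial_bound (B K R : ℝ) :
    Summable fun k : ℕ => B * (K ^ k / (k.factorial : ℝ)) * R ^ k := by
  refine ((Real.summable_pow_div_factorial (K * R)).mul_left B).congr fun k => ?_
  rw [mul_pow]; ring

variable {c : ℕ → ℂ} {B K : ℝ}

theorem summable_of_factorial_bound (hc : ∀ k, ‖c k‖ ≤ B * (K ^ k / (k.factorial : ℝ))) (z : ℂ) :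
    Summable fun k => c k * z ^ k := by
  refine Summable.of_norm_bounded (summable_pow_div_factorial_bound B K ‖z‖) fun k => ?_
  rw [norm_mul, norm_pow]
  gcongr
  exact hc k

theorem factorial_bound_deriv (hc : ∀ k, ‖c k‖ ≤ B * (K ^ k / (k.factorial : ℝ))) (k : ℕ) :
    ‖((k : ℂ) + 1) * c (k + 1)‖ ≤ B * K * (K ^ k / (k.factorial : ℝ)) := by
  have h := hc (k + 1)
  have e : ‖(k : ℂ) + 1‖ = (k : ℝ) + 1 := by
    rw [← Nat.cast_succ, Complex.norm_natCast]; simp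
  rw [norm_mul, e]
  calc ((k : ℝ) + 1) * ‖c (k + 1)‖
      ≤ ((k : ℝ) + 1) * (B * (K ^ (k + 1) / ((k + 1).factorial : ℝ))) := by gcongr
    _ = B * K * (K ^ k / (k.factorial : ℝ)) := by
      rw [Nat.factorial_succ]; push_cast
      field_simp
      ring

/-- Power series with coefficients `O(K ^ k / k!)` are entire and differentiated termwise. -/
theorem hasDerivAt_tsum_of_factorial_bound
    (hc : ∀ k, ‖c k‖ ≤ B * (K ^ k / (k.factorial : ℝ))) (z : ℂ) :
    HasDerivAt (fun w => ∑' k, c k * w ^ k) (∑' k : ℕ, (((k : ℂ) + 1) * c (k + 1)) * z ^ k) z := by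
  have hU : IsOpen (Metric.ball (0 : ℂ) (‖z‖ + 1)) := Metric.isOpen_ball
  have hz : z ∈ Metric.ball (0 : ℂ) (‖z‖ + 1) := by simp
  have hd : ∀ k : ℕ, DifferentiableOn ℂ (fun w => c k * w ^ k) (Metric.ball (0 : ℂ) (‖z‖ + 1)) :=
    fun k => by fun_prop
  have hb : ∀ (k : ℕ) (w : ℂ), w ∈ Metric.ball (0 : ℂ) (‖z‖ + 1) →
      ‖c k * w ^ k‖ ≤ B * (K ^ k / (k.factorial : ℝ)) * (‖z‖ + 1) ^ k := fun k w hw => by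
    rw [norm_mul, norm_pow]
    have hw' : ‖w‖ ≤ ‖z‖ + 1 := by simpa using (mem_ball_zero_iff.1 hw).le
    have := hc k
    have h0 : 0 ≤ B * (K ^ k / (k.factorial : ℝ)) := (norm_nonneg _).trans this
    gcongr
  have hs := summable_pow_div_factorial_bound B K (‖z‖ + 1)
  have h1 := hasSum_deriv_of_summable_norm hs hd hU hb hz
  have h2 := (differentiableOn_tsum_of_summable_norm hs hd hU hb).differentiableAt (hU.mem_nhds hz)
  have h3 : HasSum (fun k : ℕ => (((k : ℂ) + 1) * c (k + 1)) * z ^ k)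
      (deriv (fun w => ∑' k, c k * w ^ k) z) := by
    have h4 := (hasSum_nat_add_iff' 1).2 h1
    simp only [Finset.range_one, Finset.sum_singleton, pow_zero, deriv_const, sub_zero] at h4
    refine h4.congr_fun fun k => ?_
    simp
    ring
  rw [h3.tsum_eq]
  exact h2.hasDerivAt

end PowerSeries

/-! ### Kummer's function on the imaginary axis -/

section Kummer

/-- The `k`-th Taylor coefficient at `0` of `₁F₁(u, 1 + m, ·)`. -/
noncomputable def kummerCoeff (m : ℕ) (u : ℂ) (k : ℕ) : ℂ :=
  (ascPochhammer ℂ k).eval u / (ascPochhammer ℂ k).eval (1 + m : ℂ) / (k.factorial : ℂ)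

theorem hyp1F1_eq_tsum (m : ℕ) (u z : ℂ) :
    hyp1F1 u (1 + m) z = ∑' k, kummerCoeff m u k * z ^ k := by
  unfold hyp1F1 kummerCoeff
  congr 1; ext k; ring

theorem kummerCoeff_zero (m : ℕ) (u : ℂ) : kummerCoeff m u 0 = 1 := by simp [kummerCoeff]

theorem one_add_add_natCast_ne_zero (m k : ℕ) : (1 + m + k : ℂ) ≠ 0 := by
  exact_mod_cast (by omega : 1 + m + k ≠ 0)

theorem kummerCoeff_succ (m : ℕ) (u : ℂ) (k : ℕ) :
    kummerCoeff m u (k + 1) = (u + k) / ((1 + m + k) * (k + 1)) * kummerCoeff m u k := by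
  have h1 := one_add_add_natCast_ne_zero m k
  have h2 : (k + 1 : ℂ) ≠ 0 := by exact_mod_cast k.succ_ne_zero
  simp only [kummerCoeff, ascPochhammer_succ_eval, Nat.factorial_succ, Nat.cast_mul, Nat.cast_succ]
  rw [div_div, div_div, div_mul_div_comm]
  congr 1 <;> ring

/-- The bound is uniform for `u` in a disc, which gives the analyticity in `u`. -/
theorem norm_kummerCoeff_le (m : ℕ) {u : ℂ} {K : ℝ} (hK : 1 ≤ K) (hu : ‖u‖ ≤ K) (k : ℕ) :
    ‖kummerCoeff m u k‖ ≤ 1 * (K ^ k / (k.factorial : ℝ)) := by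
  induction k with
  | zero => simp [kummerCoeff_zero]
  | succ k ih =>
    have e1 : ‖(1 + m + k : ℂ)‖ = 1 + m + k := by
      rw [show (1 + m + k : ℂ) = ((1 + m + k : ℕ) : ℂ) by push_cast; ring, Complex.norm_natCast]
      push_cast; ring
    have e2 : ‖(k + 1 : ℂ)‖ = k + 1 := by
      rw [← Nat.cast_succ, Complex.norm_natCast]; push_cast; ring
    have h3 : ‖u + k‖ ≤ K * (1 + m + k) := by
      calc ‖u + k‖ ≤ ‖u‖ + ‖(k : ℂ)‖ := norm_add_le _ _
        _ ≤ K + k := by rw [Complex.norm_natCast]; gcongr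
        _ ≤ K * (1 + m + k) := by
          nlinarith [(Nat.cast_nonneg k : (0 : ℝ) ≤ k), (Nat.cast_nonneg m : (0 : ℝ) ≤ m)]
    have h4 : (0 : ℝ) < 1 + m + k := by positivity
    rw [kummerCoeff_succ, norm_mul, norm_div, norm_mul, e1, e2]
    calc ‖u + k‖ / ((1 + m + k) * (k + 1)) * ‖kummerCoeff m u k‖
        ≤ (K * (1 + m + k)) / ((1 + m + k) * (k + 1)) * (1 * (K ^ k / (k.factorial : ℝ))) := by
          gcongr
      _ = 1 * (K ^ (k + 1) / ((k + 1).factorial : ℝ)) := by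
        rw [Nat.factorial_succ]; push_cast
        field_simp
        ring

theorem exists_kummerCoeff_bound (m : ℕ) (u : ℂ) :
    ∃ K : ℝ, ∀ k, ‖kummerCoeff m u k‖ ≤ 1 * (K ^ k / (k.factorial : ℝ)) :=
  ⟨max 1 ‖u‖, norm_kummerCoeff_le m (le_max_left _ _) (le_max_right _ _)⟩

theorem hasSum_hyp1F1 (m : ℕ) (u z : ℂ) :
    HasSum (fun k => kummerCoeff m u k * z ^ k) (hyp1F1 u (1 + m) z) := by
  obtain ⟨K, hK⟩ := exists_kummerCoeff_bound m u
  rw [hyp1F1_eq_tsum]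
  exact (summable_of_factorial_bound hK z).hasSum

theorem hyp1F1_zero_right (m : ℕ) (u : ℂ) : hyp1F1 u (1 + m) 0 = 1 := by
  rw [hyp1F1_eq_tsum, tsum_eq_single 0 fun k hk => by simp [hk]]
  simp [kummerCoeff_zero]

theorem differentiable_hyp1F1_left (m : ℕ) (z : ℂ) :
    Differentiable ℂ fun u => hyp1F1 u (1 + m) z := by
  intro u
  have hd : ∀ k : ℕ, DifferentiableOn ℂ (fun u => kummerCoeff m u k * z ^ k)
      (Metric.ball (0 : ℂ) (‖u‖ + 1)) := fun k => by
    unfold kummerCoeff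
    have : Differentiable ℂ fun u => (ascPochhammer ℂ k).eval u := Polynomial.differentiable _
    fun_prop
  have hb : ∀ (k : ℕ) (w : ℂ), w ∈ Metric.ball (0 : ℂ) (‖u‖ + 1) →
      ‖kummerCoeff m w k * z ^ k‖ ≤ 1 * ((‖u‖ + 1) ^ k / (k.factorial : ℝ)) * ‖z‖ ^ k :=
    fun k w hw => by
      rw [norm_mul, norm_pow]
      gcongr
      exact norm_kummerCoeff_le m (by linarith [norm_nonneg u]) (mem_ball_zero_iff.1 hw).le k
  simp_rw [hyp1F1_eq_tsum]
  exact (differentiableOn_tsum_of_summable_norm (summable_pow_div_factorial_bound 1 _ ‖z‖)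
    hd Metric.isOpen_ball hb).differentiableAt (Metric.isOpen_ball.mem_nhds (by simp))

/-- Kummer's equation `z F'' + (v - z) F' = u F` for `F = ₁F₁(u, v, ·)` and `v = 1 + m`. -/
theorem exists_kummer_ode (m : ℕ) (u : ℂ) : ∃ F' F'' : ℂ → ℂ,
    (∀ z, HasDerivAt (hyp1F1 u (1 + m)) (F' z) z) ∧ (∀ z, HasDerivAt F' (F'' z) z) ∧
    ∀ z, z * F'' z + (1 + m - z) * F' z = u * hyp1F1 u (1 + m) z := by
  obtain ⟨K, hK⟩ := exists_kummerCoeff_bound m u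
  have hK1 := factorial_bound_deriv hK
  have hK2 := factorial_bound_deriv hK1
  refine ⟨_, _, fun z => ?_, fun z => hasDerivAt_tsum_of_factorial_bound hK1 z, fun z => ?_⟩
  · have := hasDerivAt_tsum_of_factorial_bound hK z
    rwa [← funext (hyp1F1_eq_tsum m u)] at this
  have s0 := hasSum_hyp1F1 m u z
  have s1 := (summable_of_factorial_bound hK1 z).hasSum
  have s2 := (summable_of_factorial_bound hK2 z).hasSum
  -- both `z F''` and `z F'` are reindexed as series in `z ^ k` without constant term
  have s3 : HasSum (fun k : ℕ => ((k : ℂ) * ((k + 1) * kummerCoeff m u (k + 1))) * z ^ k)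
      (z * ∑' k : ℕ,
        (((k : ℂ) + 1) * (((k + 1 : ℕ) + 1) * kummerCoeff m u (k + 1 + 1))) * z ^ k) := by
    rw [← hasSum_nat_add_iff' 1]
    simp only [Finset.range_one, Finset.sum_singleton, Nat.cast_zero, zero_mul, sub_zero]
    refine (s2.mul_left z).congr_fun fun k => ?_
    push_cast; ring
  have s4 : HasSum (fun k : ℕ => (k : ℂ) * kummerCoeff m u k * z ^ k)
      (z * ∑' k : ℕ, (((k : ℂ) + 1) * kummerCoeff m u (k + 1)) * z ^ k) := by
    rw [← hasSum_nat_add_iff' 1]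
    simp only [Finset.range_one, Finset.sum_singleton, Nat.cast_zero, zero_mul, sub_zero]
    refine (s1.mul_left z).congr_fun fun k => ?_
    push_cast; ring
  rw [sub_mul, ← add_sub_assoc]
  refine ((s3.add (s1.mul_left (1 + m : ℂ))).sub s4).unique ?_
  refine (s0.mul_left u).congr_fun fun k => ?_
  have h1 := one_add_add_natCast_ne_zero m k
  have h2 : (k + 1 : ℂ) ≠ 0 := by exact_mod_cast k.succ_ne_zero
  rw [kummerCoeff_succ]
  field_simp
  ring

theorem continuous_hyp1F1 (m : ℕ) (u : ℂ) : Continuous (hyp1F1 u (1 + m)) := by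
  obtain ⟨F', F'', h, -⟩ := exists_kummer_ode m u
  exact continuous_iff_continuousAt.2 fun z => (h z).continuousAt

/-- The zeros in `u` of `₁F₁(u, v, i y)`, `y` real, satisfy `Re u = v / 2`. With
`q(t) = ₁F₁(u, v, i t)` and `p(t) = ₁F₁'(u, v, i t)`, Kummer's equation gives
`d/dt [t ^ v (Re (p q̄) - |q|² / 2)] = (Re u - v / 2) t ^ (v - 1) |q|²`; the bracket vanishes at
`t = 0` and where `q` does, so the integral of the right side is `0`. -/
theorem re_eq_of_hyp1F1_eq_zero {m : ℕ} {u : ℂ} {y : ℝ} (hy : 0 ≤ y)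
    (h : hyp1F1 u (1 + m) (I * y) = 0) : u.re = (1 + m) / 2 := by
  rcases hy.eq_or_lt with rfl | hy
  · rw [ofReal_zero, mul_zero, hyp1F1_zero_right] at h
    exact absurd h one_ne_zero
  obtain ⟨F', F'', h1, h2, h3⟩ := exists_kummer_ode m u
  set F := hyp1F1 u (1 + m) with hF
  have hI : ∀ t : ℝ, HasDerivAt (fun t : ℝ => I * (t : ℂ)) I t := fun t => by
    simpa using (hasDerivAt_id t).ofReal_comp.const_mul I
  have hq : ∀ t : ℝ, HasDerivAt (fun t : ℝ => F (I * t)) (F' (I * t) * I) t :=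
    fun t => (h1 _).comp t (hI t)
  have hp : ∀ t : ℝ, HasDerivAt (fun t : ℝ => F' (I * t)) (F'' (I * t) * I) t :=
    fun t => (h2 _).comp t (hI t)
  have re {f : ℝ → ℂ} {f' : ℂ} {t : ℝ} (hf : HasDerivAt f f' t) :
      HasDerivAt (fun t => (f t).re) f'.re t :=
    reCLM.hasFDerivAt.comp_hasDerivAt t hf
  have im {f : ℝ → ℂ} {f' : ℂ} {t : ℝ} (hf : HasDerivAt f f' t) :
      HasDerivAt (fun t => (f t).im) f'.im t :=
    imCLM.hasFDerivAt.comp_hasDerivAt t hf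
  set W : ℝ → ℝ := fun t => t ^ (m + 1) * (((F' (I * t)).re * (F (I * t)).re
    + (F' (I * t)).im * (F (I * t)).im) - ((F (I * t)).re * (F (I * t)).re
    + (F (I * t)).im * (F (I * t)).im) / 2) with hW
  set c := u.re - (1 + m) / 2 with hc
  have hW' : ∀ t : ℝ, HasDerivAt W (c * (t ^ m * normSq (F (I * t)))) t := fun t => by
    have := (hasDerivAt_pow (m + 1) t).mul
      ((((re (hp t)).mul (re (hq t))).add ((im (hp t)).mul (im (hq t)))).sub
      ((((re (hq t)).mul (re (hq t))).add ((im (hq t)).mul (im (hq t)))).div_const 2))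
    refine this.congr_deriv ?_
    have e := h3 (I * t)
    have er := congrArg Complex.re e
    have ei := congrArg Complex.im e
    simp at er ei
    simp [normSq_apply, hc]
    generalize (F (I * t)).re = a at *
    generalize (F (I * t)).im = b at *
    generalize (F' (I * t)).re = a1 at *
    generalize (F' (I * t)).im = b1 at *
    generalize (F'' (I * t)).re = a2 at *
    generalize (F'' (I * t)).im = b2 at *
    rw [pow_succ]
    linear_combination t ^ m * a * er + t ^ m * b * ei
  have hcont : Continuous fun t : ℝ => t ^ m * normSq (F (I * t)) := by
    have := continuous_hyp1F1 m u
    exact (continuous_pow m).mul (continuous_normSq.comp (this.comp (by fun_prop)))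
  have hint := intervalIntegral.integral_eq_sub_of_hasDerivAt (a := 0) (b := y)
    (fun t _ => hW' t) ((hcont.const_mul c).intervalIntegrable _ _)
  rw [intervalIntegral.integral_const_mul] at hint
  have hWy : W y = 0 := by simp [hW, h]
  have hW0 : W 0 = 0 := by simp [hW]
  rw [hWy, hW0, sub_zero, mul_eq_zero] at hint
  have hpos : 0 < ∫ t in (0 : ℝ)..y, t ^ m * normSq (F (I * t)) := by
    refine intervalIntegral.integral_pos hy hcont.continuousOn
      (fun t ht => mul_nonneg (pow_nonneg ht.1.le m) (normSq_nonneg _)) ?_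
    have h0 : ∀ᶠ t : ℝ in nhds 0, F (I * t) ≠ 0 := by
      have hc0 : ContinuousAt (fun t : ℝ => F (I * t)) 0 := (hq 0).continuousAt
      refine hc0.eventually_ne ?_
      simp only [ofReal_zero, mul_zero, hF]
      rw [hyp1F1_zero_right]; exact one_ne_zero
    obtain ⟨t, h0t, ht⟩ := ((h0.filter_mono nhdsWithin_le_nhds).and
      (Ioc_mem_nhdsGT hy)).exists
    exact ⟨t, ⟨ht.1.le, ht.2⟩, mul_pos (pow_pos ht.1 m) (normSq_pos.2 h0t)⟩
  have := hint.resolve_right hpos.ne'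
  linarith

end Kummer

/-! ### Meromorphy and zeros of the explicit formula -/

section Zeros

open Topology

variable {a : ℝ} {β : ℂ} {m : ℕ}

/-- The factor of `zExpr a β m` other than the Gamma factor; it is entire in `s`. -/
noncomputable def zEntire (a : ℝ) (β : ℂ) (m : ℕ) (s : ℂ) : ℂ :=
  (-1) ^ m * (Complex.exp (-(Real.pi * I / 2) * (s - m / 2)) / (a : ℂ) ^ s)
    / ((2 * Real.pi : ℝ) : ℂ) ^ (s - 1) * (1 / (m.factorial : ℂ))
    * (((Real.sqrt (2 * Real.pi) / Real.sqrt a : ℝ) : ℂ) * β) ^ m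
    * hyp1F1 (s + m / 2) (1 + m) (2 * Real.pi * I * (‖β‖ : ℂ) ^ 2 / a)

theorem zExpr_eq (a : ℝ) (β : ℂ) (m : ℕ) :
    zExpr a β m = (fun s => zEntire a β m s) * fun s => Complex.Gamma (s + m / 2) := by
  ext s
  simp only [zExpr, zEntire, Pi.mul_apply]
  ring

theorem two_pi_ofReal_ne_zero : ((2 * Real.pi : ℝ) : ℂ) ≠ 0 :=
  ofReal_ne_zero.2 (by positivity)

theorem differentiable_zEntire (ha : 0 < a) : Differentiable ℂ (zEntire a β m) := by
  have h1 : Differentiable ℂ fun s : ℂ => (a : ℂ) ^ s := fun s =>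
    differentiableAt_id.const_cpow (.inl (ofReal_ne_zero.2 ha.ne'))
  have h2 : Differentiable ℂ fun s : ℂ => ((2 * Real.pi : ℝ) : ℂ) ^ (s - 1) := fun s =>
    (differentiableAt_id.sub_const 1).const_cpow (.inl two_pi_ofReal_ne_zero)
  have h3 : Differentiable ℂ fun s : ℂ =>
      hyp1F1 (s + m / 2) (1 + m) (2 * Real.pi * I * (‖β‖ : ℂ) ^ 2 / a) :=
    (differentiable_hyp1F1_left m _).comp (differentiable_id.add_const _)
  have h1' : ∀ s : ℂ, (a : ℂ) ^ s ≠ 0 := fun s => by simp [cpow_eq_zero_iff, ha.ne']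
  have h2' : ∀ s : ℂ, ((2 * Real.pi : ℝ) : ℂ) ^ (s - 1) ≠ 0 := fun s => by
    simp [cpow_eq_zero_iff, Real.pi_ne_zero]
  unfold zEntire
  fun_prop (disch := assumption)

/-- For `m = 0` or `β ≠ 0`, `zEntire` vanishes only where the confluent hypergeometric factor
does. -/
theorem re_eq_half_of_zEntire_eq_zero (ha : 0 < a) (h : m = 0 ∨ β ≠ 0) {s : ℂ}
    (hs : zEntire a β m s = 0) : s.re = 1 / 2 := by
  have h1' : (a : ℂ) ^ s ≠ 0 := by simp [cpow_eq_zero_iff, ha.ne']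
  have h2' : ((2 * Real.pi : ℝ) : ℂ) ^ (s - 1) ≠ 0 := by
    simp [cpow_eq_zero_iff, Real.pi_ne_zero]
  have h3 : (((Real.sqrt (2 * Real.pi) / Real.sqrt a : ℝ) : ℂ) * β) ^ m ≠ 0 := by
    rcases h with rfl | h
    · simp
    · refine pow_ne_zero _ (mul_ne_zero (ofReal_ne_zero.2 ?_) h)
      positivity
  have h4 : hyp1F1 (s + m / 2) (1 + m) (2 * Real.pi * I * (‖β‖ : ℂ) ^ 2 / a) = 0 := by
    refine (mul_eq_zero.1 hs).resolve_left (mul_ne_zero (mul_ne_zero (div_ne_zero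
      (mul_ne_zero (by simp) (div_ne_zero (exp_ne_zero _) h1')) h2') ?_) h3)
    simp [Nat.factorial_ne_zero]
  have h5 : (2 * Real.pi * I * (‖β‖ : ℂ) ^ 2 / a : ℂ)
      = I * ((2 * Real.pi * ‖β‖ ^ 2 / a : ℝ) : ℂ) := by push_cast; ring
  rw [h5] at h4
  have := re_eq_of_hyp1F1_eq_zero (by positivity) h4
  have e : (s + m / 2 : ℂ).re = s.re + m / 2 := by simp
  linarith

theorem meromorphicAt_Gamma_add (m : ℕ) (s : ℂ) :
    MeromorphicAt (fun s : ℂ => Complex.Gamma (s + m / 2)) s :=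
  MeromorphicAt.comp_analyticAt (f := Complex.Gamma) (g := fun s : ℂ => s + m / 2)
    (Meromorphic.Gamma (s + m / 2)) (by fun_prop)

/-- The Gamma function has no zeros, not even in the sense of a positive order. -/
theorem meromorphicOrderAt_Gamma_add_le (m : ℕ) (s : ℂ) :
    meromorphicOrderAt (fun s : ℂ => Complex.Gamma (s + m / 2)) s ≤ 0 := by
  have hR : Differentiable ℂ fun s : ℂ => (Complex.Gamma (s + m / 2))⁻¹ :=
    differentiable_one_div_Gamma.comp (differentiable_id.add_const _)
  have hA : AnalyticOnNhd ℂ (fun s : ℂ => (Complex.Gamma (s + m / 2))⁻¹) Set.univ :=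
    analyticOnNhd_univ_iff_differentiable.2 hR
  have h0 := (hA s trivial).meromorphicOrderAt_nonneg
  have htop : meromorphicOrderAt (fun s : ℂ => (Complex.Gamma (s + m / 2))⁻¹) s ≠ ⊤ := by
    intro h
    have h1 := hA.eqOn_zero_of_preconnected_of_frequently_eq_zero isPreconnected_univ trivial
      (meromorphicOrderAt_eq_top_iff.1 h).frequently
    have h2 := h1 (Set.mem_univ (1 : ℂ))
    simp only [Pi.zero_apply, inv_eq_zero] at h2
    refine Complex.Gamma_ne_zero_of_re_pos ?_ h2
    simp
    positivity
  have hinv : meromorphicOrderAt (fun s : ℂ => (Complex.Gamma (s + m / 2))⁻¹) s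
      = -meromorphicOrderAt (fun s : ℂ => Complex.Gamma (s + m / 2)) s :=
    meromorphicOrderAt_inv (f := fun s : ℂ => Complex.Gamma (s + m / 2))
  rw [hinv] at h0 htop
  generalize meromorphicOrderAt (fun s : ℂ => Complex.Gamma (s + m / 2)) s = o at h0 htop
  induction o with
  | top => exact absurd rfl htop
  | coe o =>
    have : (0 : ℤ) ≤ -o := by exact_mod_cast h0
    exact_mod_cast (by omega : o ≤ 0)

theorem meromorphicAt_zExpr (ha : 0 < a) (s : ℂ) : MeromorphicAt (zExpr a β m) s := by
  rw [zExpr_eq]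
  exact ((analyticOnNhd_univ_iff_differentiable.2 (differentiable_zEntire ha)) s
    trivial).meromorphicAt.mul (meromorphicAt_Gamma_add m s)

theorem re_eq_half_of_meromorphicOrderAt_zExpr_pos (ha : 0 < a) (h : m = 0 ∨ β ≠ 0) {s : ℂ}
    (hs : 0 < meromorphicOrderAt (zExpr a β m) s) : s.re = 1 / 2 := by
  by_contra hne
  have hA : AnalyticAt ℂ (zEntire a β m) s :=
    (analyticOnNhd_univ_iff_differentiable.2 (differentiable_zEntire ha)) s trivial
  have h0 : zEntire a β m s ≠ 0 := fun h0 => hne (re_eq_half_of_zEntire_eq_zero ha h h0)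
  have h1 : meromorphicOrderAt (zEntire a β m) s = 0 := by
    rw [hA.meromorphicOrderAt_eq, hA.analyticOrderAt_eq_zero.2 h0]; rfl
  rw [zExpr_eq, meromorphicOrderAt_mul hA.meromorphicAt (meromorphicAt_Gamma_add m s), h1,
    zero_add] at hs
  exact absurd (meromorphicOrderAt_Gamma_add_le m s) (not_le.2 hs)

theorem re_eq_half_of_zExpr_eq_zero (ha : 0 < a) (h : m = 0 ∨ β ≠ 0) {s : ℂ} (hs : 0 < s.re)
    (h0 : zExpr a β m s = 0) : s.re = 1 / 2 := by
  rw [zExpr_eq] at h0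
  refine re_eq_half_of_zEntire_eq_zero ha h ((mul_eq_zero.1 h0).resolve_right ?_)
  refine Complex.Gamma_ne_zero_of_re_pos ?_
  simp
  positivity

end Zeros

/-! ### The multiplicative Haar measure and the characters of `ℂ^×` -/

section Haar

open Set

theorem absC_ne_zero {z : ℂ} (hz : z ≠ 0) : absC z ≠ 0 := by simp [absC, hz]

theorem absC_pos {z : ℂ} (hz : z ≠ 0) : 0 < absC z := by
  unfold absC; have := norm_pos_iff.2 hz; positivity

theorem absC_mul (x z : ℂ) : absC (x * z) = absC x * absC z := by
  simp [absC, mul_pow]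

theorem continuous_absC : Continuous absC := by unfold absC; fun_prop

@[fun_prop]
theorem measurable_absC : Measurable absC := continuous_absC.measurable

theorem measurable_ofReal_inv_absC : Measurable fun z => ENNReal.ofReal (absC z)⁻¹ := by
  fun_prop

instance : SFinite mulHaarC := by unfold mulHaarC addHaarC; infer_instance

theorem mulHaarC_absolutelyContinuous : mulHaarC ≪ (volume : Measure ℂ) :=
  (withDensity_absolutelyContinuous _ _).trans (Measure.smul_absolutelyContinuous)

theorem ae_ne_zero : ∀ᵐ z ∂mulHaarC, z ≠ 0 :=
  mulHaarC_absolutelyContinuous.ae_le (Measure.ae_ne volume 0)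

theorem integral_mulHaarC {E : Type*} [NormedAddCommGroup E] [NormedSpace ℝ E] (g : ℂ → E) :
    ∫ z, g z ∂mulHaarC = (2 : ℝ) • ∫ z, (absC z)⁻¹ • g z := by
  have h0 : ∀ z, 0 ≤ (absC z)⁻¹ := fun z => by unfold absC; positivity
  rw [mulHaarC, integral_withDensity_eq_integral_toReal_smul measurable_ofReal_inv_absC
    (by simp), addHaarC, integral_smul_measure]
  simp [ENNReal.toReal_ofReal (h0 _)]

theorem integrable_mulHaarC_iff {E : Type*} [NormedAddCommGroup E] [NormedSpace ℝ E]
    {g : ℂ → E} : Integrable g mulHaarC ↔ Integrable (fun z => (absC z)⁻¹ • g z) := by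
  have h0 : ∀ z, 0 ≤ (absC z)⁻¹ := fun z => by unfold absC; positivity
  rw [mulHaarC, integrable_withDensity_iff_integrable_smul' measurable_ofReal_inv_absC
    (by simp), addHaarC, integrable_smul_measure (by simp) (by simp)]
  simp [ENNReal.toReal_ofReal (h0 _)]

/-- `d^×z` is invariant under multiplication: the Jacobian of `z ↦ x z` is `|x|_ℂ`. -/
theorem measurePreserving_mul {x : ℂ} (hx : x ≠ 0) :
    MeasurePreserving (fun z => x * z) mulHaarC mulHaarC := by
  have hm : Measurable fun z : ℂ => x * z := by fun_prop
  refine ⟨hm, Measure.ext_of_lintegral _ fun f hf => ?_⟩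
  have hdet : LinearMap.det (LinearMap.mulLeft ℝ x) = absC x := by
    have := Algebra.norm_complex_apply x
    rw [Algebra.norm_apply, normSq_eq_norm_sq] at this
    exact this
  have hmap : Measure.map (fun z => x * z) (volume : Measure ℂ)
      = ENNReal.ofReal (absC x)⁻¹ • volume := by
    have := Measure.map_linearMap_addHaar_eq_smul_addHaar (volume : Measure ℂ)
      (f := LinearMap.mulLeft ℝ x) (by rw [hdet]; exact absC_ne_zero hx)
    rwa [hdet, abs_of_pos (inv_pos.2 (absC_pos hx))] at this
  rw [lintegral_map hf hm, mulHaarC, lintegral_withDensity_eq_lintegral_mul _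
    measurable_ofReal_inv_absC (g := fun z => f (x * z)) (hf.comp hm),
    lintegral_withDensity_eq_lintegral_mul _
    measurable_ofReal_inv_absC hf, addHaarC, lintegral_smul_measure, lintegral_smul_measure]
  congr 1
  set h : ℂ → ENNReal := fun z => ENNReal.ofReal (absC z)⁻¹ * f z with hh
  have hmh : Measurable h := measurable_ofReal_inv_absC.mul hf
  have e : ∀ z, ((fun z => ENNReal.ofReal (absC z)⁻¹) * (fun z => f (x * z))) z
      = ENNReal.ofReal (absC x) * h (x * z) := fun z => by
    simp only [hh, Pi.mul_apply, absC_mul, mul_inv]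
    rw [ENNReal.ofReal_mul (inv_pos.2 (absC_pos hx)).le, ← mul_assoc, ← mul_assoc,
      ← ENNReal.ofReal_mul (absC_pos hx).le, mul_inv_cancel₀ (absC_ne_zero hx)]
    simp
  change ∫⁻ z, ((fun z => ENNReal.ofReal (absC z)⁻¹) * (fun z => f (x * z))) z = ∫⁻ z, h z
  simp_rw [e]
  rw [lintegral_const_mul (f := fun z => h (x * z)) _ (hmh.comp hm),
    ← lintegral_map (g := fun z => x * z) hmh hm, hmap,
    lintegral_smul_measure, smul_eq_mul, ← mul_assoc, ← ENNReal.ofReal_mul (absC_pos hx).le,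
    mul_inv_cancel₀ (absC_ne_zero hx)]
  simp

theorem measurableEmbedding_mul {x : ℂ} (hx : x ≠ 0) : MeasurableEmbedding fun z => x * z :=
  (Homeomorph.mulLeft₀ x hx).measurableEmbedding

theorem integral_comp_mul {E : Type*} [NormedAddCommGroup E] [NormedSpace ℝ E] {x : ℂ}
    (hx : x ≠ 0) (g : ℂ → E) : ∫ z, g (x * z) ∂mulHaarC = ∫ z, g z ∂mulHaarC :=
  (measurePreserving_mul hx).integral_comp (measurableEmbedding_mul hx) g

theorem integrable_comp_mul {E : Type*} [NormedAddCommGroup E] {x : ℂ}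
    (hx : x ≠ 0) {g : ℂ → E} : Integrable (fun z => g (x * z)) mulHaarC ↔ Integrable g mulHaarC :=
  (measurePreserving_mul hx).integrable_comp_emb (measurableEmbedding_mul hx)

theorem integral_mulHaarC_norm {E : Type*} [NormedAddCommGroup E] [NormedSpace ℝ E] (g : ℝ → E) :
    ∫ z, g ‖z‖ ∂mulHaarC = (4 * Real.pi) • ∫ r in Ioi (0 : ℝ), r⁻¹ • g r := by
  rw [integral_mulHaarC]
  simp only [absC]
  rw [integral_fun_norm_addHaar volume fun r : ℝ => (r ^ 2)⁻¹ • g r, Complex.finrank_real_complex,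
    Measure.real, Complex.volume_ball]
  have : ∫ y in Ioi (0 : ℝ), y ^ (2 - 1) • (y ^ 2)⁻¹ • g y = ∫ r in Ioi (0 : ℝ), r⁻¹ • g r := by
    refine setIntegral_congr_fun measurableSet_Ioi fun r (hr : 0 < r) => ?_
    simp only [smul_smul]
    congr 1
    rw [show 2 - 1 = 1 from rfl]
    field_simp
  rw [this, ← Nat.cast_smul_eq_nsmul ℝ, smul_smul, smul_smul]
  congr 1
  simp
  ring

theorem integrable_mulHaarC_norm {E : Type*} [NormedAddCommGroup E] [NormedSpace ℝ E] {g : ℝ → E} :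
    Integrable (fun z : ℂ => g ‖z‖) mulHaarC ↔ IntegrableOn (fun r => r⁻¹ • g r) (Ioi 0) := by
  rw [integrable_mulHaarC_iff]
  simp only [absC]
  rw [integrable_fun_norm_addHaar volume (f := fun r : ℝ => (r ^ 2)⁻¹ • g r),
    Complex.finrank_real_complex]
  refine integrableOn_congr_fun (fun r (hr : 0 < r) => ?_) measurableSet_Ioi
  simp only [smul_smul]
  congr 1
  rw [show 2 - 1 = 1 from rfl]
  field_simp

theorem norm_unitChar {z : ℂ} (hz : z ≠ 0) (n : ℤ) : ‖unitChar n z‖ = 1 := by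
  simp [unitChar, hz]

theorem unitChar_mul (n : ℤ) (x z : ℂ) : unitChar n (x * z) = unitChar n x * unitChar n z := by
  simp only [unitChar, norm_mul, ofReal_mul, mul_div_mul_comm, mul_zpow]

theorem measurable_unitChar (n : ℤ) : Measurable (unitChar n) := by
  unfold unitChar
  have : Measurable fun z : ℂ => z / (‖z‖ : ℂ) := by fun_prop
  cases n with
  | ofNat k => simpa using this.pow_const k
  | negSucc k =>
    simp only [zpow_negSucc]
    exact (this.pow_const (k + 1)).inv

theorem norm_absC_cpow {z : ℂ} (hz : z ≠ 0) (s : ℂ) :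
    ‖(absC z : ℂ) ^ s‖ = ‖z‖ ^ (2 * s.re) := by
  rw [norm_cpow_eq_rpow_re_of_pos (absC_pos hz), absC, ← Real.rpow_natCast, ← Real.rpow_mul
    (norm_nonneg z)]
  norm_num

theorem norm_mellinIntegrand (f : ℂ → ℂ) (s : ℂ) (n : ℤ) {z : ℂ} (hz : z ≠ 0) :
    ‖mellinIntegrand f s n z‖ = ‖f z‖ * ‖z‖ ^ (2 * s.re) := by
  rw [mellinIntegrand, norm_mul, norm_mul, norm_unitChar hz, norm_absC_cpow hz, mul_one]

theorem absC_mul_cpow (x z s : ℂ) :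
    (absC (x * z) : ℂ) ^ s = (absC x : ℂ) ^ s * (absC z : ℂ) ^ s := by
  rw [absC_mul, ofReal_mul, mul_cpow_ofReal_nonneg] <;> unfold absC <;> positivity

/-- A radial function is orthogonal to every nontrivial unitary character of `ℂ^×`. -/
theorem integral_norm_mul_unitChar {l : ℤ} (hl : l ≠ 0) (g : ℝ → ℂ) :
    ∫ z : ℂ, g ‖z‖ * unitChar l z ∂mulHaarC = 0 := by
  -- rotation by `ζ = exp (π i / l)` changes the sign of the integrand
  set ζ : ℂ := Complex.exp ((Real.pi / l : ℝ) * I) with hζ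
  have h1 : ‖ζ‖ = 1 := norm_exp_ofReal_mul_I _
  have h2 : unitChar l ζ = -1 := by
    rw [unitChar, h1, ofReal_one, div_one, hζ, ← exp_int_mul, ← exp_pi_mul_I]
    congr 1
    push_cast
    have : (l : ℂ) ≠ 0 := by exact_mod_cast hl
    field_simp
  have h3 := integral_comp_mul (show ζ ≠ 0 from exp_ne_zero _) fun z : ℂ => g ‖z‖ * unitChar l z
  simp only [norm_mul, h1, one_mul, unitChar_mul, h2, neg_mul, mul_neg, integral_neg] at h3
  linear_combination (-1 / 2 : ℂ) * h3

end Haar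

/-! ### Laplace and Gaussian integrals with a complex parameter -/

section Laplace

open Set Topology

theorem integrableOn_rpow_mul_exp {σ r : ℝ} (hσ : 0 < σ) (hr : 0 < r) :
    IntegrableOn (fun t : ℝ => t ^ (σ - 1) * Real.exp (-(r * t))) (Ioi 0) := by
  have := integrableOn_rpow_mul_exp_neg_mul_rpow (s := σ - 1) (p := 1) (by linarith) one_pos hr
  simpa using this

theorem aestronglyMeasurable_cpow_mul_exp (w A : ℂ) :
    AEStronglyMeasurable (fun t : ℝ => (t : ℂ) ^ w * Complex.exp (-(A * t)))
      (volume.restrict (Ioi 0)) := by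
  refine ContinuousOn.aestronglyMeasurable (fun t (ht : 0 < t) => ?_) measurableSet_Ioi
  have : ContinuousAt (fun t : ℝ => (t : ℂ) ^ w) t :=
    continuousAt_ofReal_cpow_const _ _ (.inr ht.ne')
  exact (this.mul (by fun_prop)).continuousWithinAt

theorem norm_cpow_mul_exp {t : ℝ} (ht : 0 < t) (w A : ℂ) :
    ‖(t : ℂ) ^ w * Complex.exp (-(A * t))‖ = t ^ w.re * Real.exp (-(A.re * t)) := by
  rw [norm_mul, norm_cpow_eq_rpow_re_of_pos ht, norm_exp]
  simp

/-- The Laplace transform of `t ^ (w - 1)`, for a complex parameter `A`. Both sides are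
holomorphic in `A` on the right half plane and agree for real `A`. -/
theorem integral_cpow_mul_exp_neg_mul {w A : ℂ} (hw : 0 < w.re) (hA : 0 < A.re) :
    ∫ t in Ioi (0 : ℝ), (t : ℂ) ^ (w - 1) * Complex.exp (-(A * t))
      = A ^ (-w) * Complex.Gamma w := by
  set U : Set ℂ := {A | 0 < A.re} with hU
  have hUo : IsOpen U := isOpen_lt continuous_const continuous_re
  have hL : DifferentiableOn ℂ
      (fun A => ∫ t in Ioi (0 : ℝ), (t : ℂ) ^ (w - 1) * Complex.exp (-(A * t))) U := by
    intro B hB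
    have hB : 0 < B.re := hB
    have key := hasDerivAt_integral_of_dominated_loc_of_deriv_le
      (μ := volume.restrict (Ioi (0 : ℝ))) (x₀ := B) (s := Metric.ball B (B.re / 2))
      (F := fun A (t : ℝ) => (t : ℂ) ^ (w - 1) * Complex.exp (-(A * t)))
      (F' := fun A (t : ℝ) => (t : ℂ) ^ (w - 1) * (Complex.exp (-(A * t)) * (-t)))
      (bound := fun t : ℝ => t ^ (w.re + 1 - 1) * Real.exp (-(B.re / 2 * t)))
      (Metric.ball_mem_nhds _ (by positivity))
      (.of_forall fun A => aestronglyMeasurable_cpow_mul_exp _ _) ?_ ?_ ?_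
      (integrableOn_rpow_mul_exp (by linarith) (by positivity)) ?_
    · exact key.2.differentiableAt.differentiableWithinAt
    · refine (integrableOn_rpow_mul_exp hw hB).mono'
        (aestronglyMeasurable_cpow_mul_exp _ _) ?_
      filter_upwards [ae_restrict_mem measurableSet_Ioi] with t ht
      rw [norm_cpow_mul_exp ht]
      simp
    · have := (aestronglyMeasurable_cpow_mul_exp (w - 1) B).mul
        (Continuous.aestronglyMeasurable (f := fun t : ℝ => (-(t : ℂ))) (by fun_prop))
      refine this.congr (.of_forall fun t => ?_)
      simp only [Pi.mul_apply]; ring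
    · filter_upwards [ae_restrict_mem measurableSet_Ioi] with t (ht : 0 < t) A hAB
      rw [← mul_assoc, norm_mul, norm_cpow_mul_exp ht, norm_neg, norm_real,
        Real.norm_of_nonneg ht.le, mul_right_comm, ← Real.rpow_add_one ht.ne']
      have h1 : B.re / 2 ≤ A.re := by
        have h2 := (abs_re_le_norm (A - B)).trans (mem_ball_iff_norm.1 hAB).le
        rw [sub_re] at h2
        linarith [(abs_le.1 h2).1]
      simp only [sub_re, one_re, sub_add_cancel, add_sub_cancel_right]
      gcongr
    · refine .of_forall fun t A _ => ?_
      have h1 : HasDerivAt (fun A : ℂ => -(A * t)) (-t : ℂ) A := by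
        have := ((hasDerivAt_id A).mul_const (t : ℂ)).fun_neg
        rwa [one_mul] at this
      exact h1.cexp.const_mul _
  have hR : DifferentiableOn ℂ (fun A : ℂ => A ^ (-w) * Complex.Gamma w) U := by
    intro B hB
    have : DifferentiableAt ℂ (fun A : ℂ => A ^ (-w)) B :=
      differentiableAt_id.cpow (differentiableAt_const _) (.inl hB)
    exact (this.mul_const _).differentiableWithinAt
  refine AnalyticOnNhd.eqOn_of_preconnected_of_frequently_eq (hL.analyticOnNhd hUo)
    (hR.analyticOnNhd hUo) (convex_halfSpace_re_gt 0).isPreconnected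
    (show (1 : ℂ) ∈ U by simp [hU]) ?_ hA
  have ht : Filter.Tendsto (fun r : ℝ => (r : ℂ)) (𝓝[≠] 1) (𝓝[≠] ((1 : ℝ) : ℂ)) :=
    continuous_ofReal.continuousWithinAt.tendsto_nhdsWithin fun r hr => by simpa using hr
  rw [ofReal_one] at ht
  refine ht.frequently (Filter.Eventually.frequently ?_)
  filter_upwards [nhdsWithin_le_nhds (lt_mem_nhds (one_pos : (0 : ℝ) < 1))] with r hr
  rw [Complex.integral_cpow_mul_exp_neg_mul_Ioi hw hr, one_div, cpow_neg, inv_cpow]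
  rw [arg_ofReal_of_nonneg hr.le]
  exact Real.pi_pos.ne

/-- The Mellin transform of the Gaussian `exp (-A |z|²)`. -/
theorem integral_gaussian_mul_absC_cpow {w A : ℂ} (hw : 0 < w.re) (hA : 0 < A.re) :
    ∫ z : ℂ, Complex.exp (-(A * (‖z‖ : ℂ) ^ 2)) * (absC z : ℂ) ^ w ∂mulHaarC
      = 2 * Real.pi * (A ^ (-w) * Complex.Gamma w) := by
  have h1 := integral_mulHaarC_norm
    fun r => Complex.exp (-(A * (r : ℂ) ^ 2)) * ((r ^ 2 : ℝ) : ℂ) ^ w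
  have h2 := integral_comp_rpow_Ioi_of_pos
    (g := fun t : ℝ => (t : ℂ) ^ (w - 1) * Complex.exp (-(A * t))) (p := 2) two_pos
  rw [integral_cpow_mul_exp_neg_mul hw hA] at h2
  unfold absC
  rw [h1, ← h2, ← integral_smul, ← integral_const_mul]
  refine setIntegral_congr_fun measurableSet_Ioi fun r (hr : 0 < r) => ?_
  have h3 : ((r ^ 2 : ℝ) : ℂ) ≠ 0 := by exact_mod_cast (by positivity : r ^ 2 ≠ 0)
  have h4 : (r : ℂ) ≠ 0 := by exact_mod_cast hr.ne'
  simp only [Real.rpow_two, real_smul]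
  rw [cpow_sub _ _ h3, cpow_one, show (2 : ℝ) - 1 = 1 by norm_num, Real.rpow_one]
  push_cast
  field_simp
  ring

theorem integrable_exp_mul_rpow {α c σ : ℝ} (hα : 0 < α) (hσ : 0 < σ) :
    Integrable (fun z : ℂ => Real.exp (-(α * ‖z‖ ^ 2)) * Real.exp (c * ‖z‖) * ‖z‖ ^ (2 * σ))
      mulHaarC := by
  rw [integrable_mulHaarC_norm
    (g := fun r => Real.exp (-(α * r ^ 2)) * Real.exp (c * r) * r ^ (2 * σ))]
  have h1 := (integrableOn_rpow_mul_exp_neg_mul_sq (b := α / 2) (by positivity)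
    (s := 2 * σ - 1) (by linarith)).const_mul (Real.exp (c ^ 2 / (2 * α)))
  refine h1.mono' ?_ ?_
  · refine ContinuousOn.aestronglyMeasurable (fun r (hr : 0 < r) => ?_) measurableSet_Ioi
    have : r ≠ 0 := hr.ne'
    refine ContinuousAt.continuousWithinAt ?_
    fun_prop (disch := first | assumption | exact .inl this)
  · filter_upwards [ae_restrict_mem measurableSet_Ioi] with r (hr : 0 < r)
    rw [smul_eq_mul, Real.norm_of_nonneg (by positivity), Real.rpow_sub_one hr.ne']
    have : Real.exp (-(α * r ^ 2)) * Real.exp (c * r)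
        ≤ Real.exp (c ^ 2 / (2 * α)) * Real.exp (-(α / 2) * r ^ 2) := by
      rw [← Real.exp_add, ← Real.exp_add, Real.exp_le_exp]
      have : c ^ 2 / (2 * α) + -(α / 2) * r ^ 2 - (-(α * r ^ 2) + c * r)
          = (α * r - c) ^ 2 / (2 * α) := by field_simp; ring
      have h0 : 0 ≤ (α * r - c) ^ 2 / (2 * α) := by positivity
      linarith
    calc r⁻¹ * (Real.exp (-(α * r ^ 2)) * Real.exp (c * r) * r ^ (2 * σ))
        ≤ r⁻¹ * (Real.exp (c ^ 2 / (2 * α)) * Real.exp (-(α / 2) * r ^ 2) * r ^ (2 * σ)) := by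
          gcongr
      _ = _ := by ring

end Laplace

/-! ### The Mellin transform of the regularized character -/

section Regularized

open Set

/-- The regularized character `exp (-A |z|² - 2πi (b z + conj (b z)))`. It is absolutely Mellin
transformable for `0 < Re A`, and equals `gaussChar a b` for `A = 2πi a`. -/
noncomputable def gaussReg (A b z : ℂ) : ℂ :=
  Complex.exp (-(A * (‖z‖ : ℂ) ^ 2))
    * (Complex.exp (-2 * Real.pi * I * (b * z)) * Complex.exp (-2 * Real.pi * I * conj (b * z)))

theorem gaussChar_eq_gaussReg (a : ℝ) (b z : ℂ) :
    gaussChar a b z = gaussReg (2 * Real.pi * I * a) b z := by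
  unfold gaussChar psiC gaussReg
  rw [← Complex.exp_add, ← Complex.exp_add]
  congr 1
  simp only [map_add, map_mul, map_div₀, map_pow, conj_ofReal, map_ofNat]
  ring

theorem norm_gaussReg (A b z : ℂ) : ‖gaussReg A b z‖ = Real.exp (-(A.re * ‖z‖ ^ 2)) := by
  unfold gaussReg
  rw [← Complex.exp_add, norm_mul, norm_exp, norm_exp]
  have h1 : (-(A * (‖z‖ : ℂ) ^ 2)).re = -(A.re * ‖z‖ ^ 2) := by
    rw [← ofReal_pow, neg_re, re_mul_ofReal]
  have h2 : (-2 * Real.pi * I * (b * z) + -2 * Real.pi * I * conj (b * z)).re = 0 := by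
    rw [← mul_add, add_conj]
    simp
  rw [h1, h2, Real.exp_zero, mul_one]

theorem continuous_gaussReg (A b : ℂ) : Continuous (gaussReg A b) := by
  unfold gaussReg; fun_prop

/-- The term of index `(j, k)` in the expansion of the integrand of the Mellin transform of
`gaussReg A b` in powers of `z` and `conj z`. -/
noncomputable def gaussTerm (A b s : ℂ) (n : ℤ) (p : ℕ × ℕ) (z : ℂ) : ℂ :=
  Complex.exp (-(A * (‖z‖ : ℂ) ^ 2)) * ((-2 * Real.pi * I * (b * z)) ^ p.1 / (p.1.factorial : ℂ)
    * ((-2 * Real.pi * I * conj (b * z)) ^ p.2 / (p.2.factorial : ℂ)))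
    * (absC z : ℂ) ^ s * unitChar n z

theorem summable_norm_pow_div_factorial (w : ℂ) :
    Summable fun k : ℕ => ‖w ^ k / (k.factorial : ℂ)‖ := by
  simpa [norm_div] using Real.summable_pow_div_factorial ‖w‖

theorem hasSum_cexp (w : ℂ) :
    HasSum (fun k : ℕ => w ^ k / (k.factorial : ℂ)) (Complex.exp w) := by
  rw [Complex.exp_eq_exp_ℂ]
  exact NormedSpace.expSeries_div_hasSum_exp w

theorem hasSum_cexp_mul_cexp (x y : ℂ) :
    HasSum (fun p : ℕ × ℕ => x ^ p.1 / (p.1.factorial : ℂ) * (y ^ p.2 / (p.2.factorial : ℂ)))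
      (Complex.exp x * Complex.exp y) :=
  HasSum.mul (f := fun k : ℕ => x ^ k / (k.factorial : ℂ))
    (g := fun k : ℕ => y ^ k / (k.factorial : ℂ)) (hasSum_cexp x) (hasSum_cexp y)
    (summable_mul_of_summable_norm (f := fun k : ℕ => x ^ k / (k.factorial : ℂ))
      (g := fun k : ℕ => y ^ k / (k.factorial : ℂ)) (summable_norm_pow_div_factorial x)
      (summable_norm_pow_div_factorial y))

theorem hasSum_gaussTerm (A b s : ℂ) (n : ℤ) (z : ℂ) :
    HasSum (fun p => gaussTerm A b s n p z) (mellinIntegrand (gaussReg A b) s n z) := by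
  simp only [gaussTerm, mellinIntegrand, gaussReg]
  exact (((hasSum_cexp_mul_cexp _ _).mul_left _).mul_right _).mul_right _

theorem hasSum_exp_mul_exp (x : ℝ) (hx : 0 ≤ x) :
    HasSum (fun p : ℕ × ℕ => x ^ p.1 / (p.1.factorial : ℝ) * (x ^ p.2 / (p.2.factorial : ℝ)))
      (Real.exp (2 * x)) := by
  have h : HasSum (fun k : ℕ => x ^ k / (k.factorial : ℝ)) (Real.exp x) := by
    rw [Real.exp_eq_exp_ℝ]
    exact NormedSpace.expSeries_div_hasSum_exp x
  rw [two_mul, Real.exp_add]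
  exact h.mul h (h.summable.mul_of_nonneg h.summable (fun k => by positivity)
    fun k => by positivity)

theorem measurable_gaussTerm (A b s : ℂ) (n : ℤ) (p : ℕ × ℕ) :
    Measurable (gaussTerm A b s n p) := by
  have := measurable_unitChar n
  unfold gaussTerm
  refine Measurable.mul (Measurable.mul ?_ (by fun_prop)) this
  exact Continuous.measurable (by fun_prop)

theorem norm_gaussTerm (A b s : ℂ) (n : ℤ) (p : ℕ × ℕ) {z : ℂ} (hz : z ≠ 0) :
    ‖gaussTerm A b s n p z‖ = Real.exp (-(A.re * ‖z‖ ^ 2)) *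
      ((2 * Real.pi * ‖b‖ * ‖z‖) ^ p.1 / (p.1.factorial : ℝ)
        * ((2 * Real.pi * ‖b‖ * ‖z‖) ^ p.2 / (p.2.factorial : ℝ))) * ‖z‖ ^ (2 * s.re) := by
  have h1 : (-(A * (‖z‖ : ℂ) ^ 2)).re = -(A.re * ‖z‖ ^ 2) := by
    rw [← ofReal_pow, neg_re, re_mul_ofReal]
  have h2 : ∀ w : ℂ, ‖-2 * Real.pi * I * w‖ = 2 * Real.pi * ‖w‖ := fun w => by
    simp [abs_of_pos Real.pi_pos]
  rw [gaussTerm, norm_mul, norm_mul, norm_unitChar hz, norm_absC_cpow hz, mul_one, norm_mul,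
    norm_exp, h1, norm_mul, norm_div, norm_div, norm_pow, norm_pow, h2, h2, RCLike.norm_conj,
    norm_mul, Complex.norm_natCast, Complex.norm_natCast, mul_assoc (2 * Real.pi)]

theorem integrable_mellinIntegrand_gaussReg {A s : ℂ} (b : ℂ) (n : ℤ) (hA : 0 < A.re)
    (hs : 0 < s.re) : Integrable (mellinIntegrand (gaussReg A b) s n) mulHaarC := by
  refine (integrable_exp_mul_rpow (c := 0) hA hs).mono' ?_ ?_
  · have := measurable_unitChar n
    have := (continuous_gaussReg A b).measurable
    unfold mellinIntegrand
    exact Measurable.aestronglyMeasurable (by fun_prop)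
  · filter_upwards [ae_ne_zero] with z hz
    rw [norm_mellinIntegrand _ _ _ hz, norm_gaussReg]
    simp

theorem hasSum_integral_gaussTerm {A s : ℂ} (b : ℂ) (n : ℤ) (hA : 0 < A.re) (hs : 0 < s.re) :
    HasSum (fun p => ∫ z, gaussTerm A b s n p z ∂mulHaarC) (mellinC (gaussReg A b) s n) := by
  have hb : ∀ z : ℂ, HasSum (fun p : ℕ × ℕ => Real.exp (-(A.re * ‖z‖ ^ 2)) *
      ((2 * Real.pi * ‖b‖ * ‖z‖) ^ p.1 / (p.1.factorial : ℝ)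
        * ((2 * Real.pi * ‖b‖ * ‖z‖) ^ p.2 / (p.2.factorial : ℝ))) * ‖z‖ ^ (2 * s.re))
      (Real.exp (-(A.re * ‖z‖ ^ 2)) * Real.exp (4 * Real.pi * ‖b‖ * ‖z‖) * ‖z‖ ^ (2 * s.re)) :=
    fun z => by
      have := hasSum_exp_mul_exp (2 * Real.pi * ‖b‖ * ‖z‖) (by positivity)
      rw [show 2 * (2 * Real.pi * ‖b‖ * ‖z‖) = 4 * Real.pi * ‖b‖ * ‖z‖ by ring] at this
      exact (this.mul_left _).mul_right _
  refine hasSum_integral_of_dominated_convergence _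
    (fun p => (measurable_gaussTerm A b s n p).aestronglyMeasurable) (fun p => ?_)
    (.of_forall fun z => (hb z).summable) ?_ (.of_forall fun z => hasSum_gaussTerm A b s n z)
  · filter_upwards [ae_ne_zero] with z hz using (norm_gaussTerm A b s n p hz).le
  · simp_rw [(hb _).tsum_eq]
    exact integrable_exp_mul_rpow hA hs

theorem absC_cpow_div_two {z : ℂ} (hz : z ≠ 0) (l : ℕ) :
    (absC z : ℂ) ^ ((l : ℂ) / 2) = (‖z‖ : ℂ) ^ l := by
  have : ((l : ℂ) / 2) = ((l / 2 : ℝ) : ℂ) := by push_cast; ring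
  rw [this, ← ofReal_cpow (absC_pos hz).le, absC, ← Real.rpow_natCast, ← Real.rpow_mul
    (norm_nonneg z), ← ofReal_pow, ← Real.rpow_natCast]
  congr 2
  push_cast
  ring

theorem pow_eq_norm_pow_mul_unitChar {z : ℂ} (hz : z ≠ 0) (j : ℕ) :
    z ^ j = (‖z‖ : ℂ) ^ j * unitChar j z := by
  have : (‖z‖ : ℂ) ≠ 0 := by simpa using hz
  rw [unitChar, zpow_natCast, ← mul_pow]
  congr 1
  field_simp

theorem conj_pow_eq_norm_pow_mul_unitChar {z : ℂ} (hz : z ≠ 0) (k : ℕ) :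
    conj z ^ k = (‖z‖ : ℂ) ^ k * unitChar (-k) z := by
  have : (‖z‖ : ℂ) ≠ 0 := by simpa using hz
  rw [unitChar, zpow_neg, zpow_natCast, ← inv_pow, ← mul_pow]
  congr 1
  have h := mul_conj' z
  field_simp
  linear_combination h

theorem unitChar_add {z : ℂ} (hz : z ≠ 0) (n l : ℤ) :
    unitChar (n + l) z = unitChar n z * unitChar l z :=
  zpow_add₀ (div_ne_zero hz (by simpa using hz)) _ _

theorem gaussTerm_eq (A b s : ℂ) (n : ℤ) (p : ℕ × ℕ) {z : ℂ} (hz : z ≠ 0) :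
    gaussTerm A b s n p z = ((-2 * Real.pi * I * b) ^ p.1 / (p.1.factorial : ℂ)
      * ((-2 * Real.pi * I * conj b) ^ p.2 / (p.2.factorial : ℂ)))
      * (Complex.exp (-(A * (‖z‖ : ℂ) ^ 2)) * (absC z : ℂ) ^ (s + ((p.1 + p.2 : ℕ) : ℂ) / 2)
        * unitChar (n + p.1 - p.2) z) := by
  have h0 : (absC z : ℂ) ≠ 0 := ofReal_ne_zero.2 (absC_ne_zero hz)
  rw [gaussTerm, cpow_add _ _ h0, absC_cpow_div_two hz, sub_eq_add_neg, unitChar_add hz,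
    unitChar_add hz, map_mul, ← mul_assoc (-2 * Real.pi * I) b, ← mul_assoc (-2 * Real.pi * I),
    mul_pow _ z, mul_pow _ (conj z), pow_eq_norm_pow_mul_unitChar hz,
    conj_pow_eq_norm_pow_mul_unitChar hz, pow_add]
  ring

theorem integral_gaussTerm {A s : ℂ} (b : ℂ) (n : ℤ) (p : ℕ × ℕ) (hA : 0 < A.re)
    (hs : 0 < s.re) : ∫ z, gaussTerm A b s n p z ∂mulHaarC
      = if n + p.1 = p.2 then ((-2 * Real.pi * I * b) ^ p.1 / (p.1.factorial : ℂ)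
        * ((-2 * Real.pi * I * conj b) ^ p.2 / (p.2.factorial : ℂ)))
        * (2 * Real.pi * (A ^ (-(s + ((p.1 + p.2 : ℕ) : ℂ) / 2))
          * Complex.Gamma (s + ((p.1 + p.2 : ℕ) : ℂ) / 2))) else 0 := by
  rw [integral_congr_ae (ae_ne_zero.mono fun z hz => gaussTerm_eq A b s n p hz), integral_const_mul]
  split_ifs with h
  · rw [← integral_gaussian_mul_absC_cpow _ hA]
    · simp [h, unitChar]
    · have : (s + ((p.1 + p.2 : ℕ) : ℂ) / 2).re = s.re + ((p.1 + p.2 : ℕ) : ℝ) / 2 := by simp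
      rw [this]
      positivity
  · have := integral_norm_mul_unitChar (l := n + p.1 - p.2) (by omega) fun r =>
      Complex.exp (-(A * (r : ℂ) ^ 2)) * ((r ^ 2 : ℝ) : ℂ) ^ (s + ((p.1 + p.2 : ℕ) : ℂ) / 2)
    unfold absC
    rw [this, mul_zero]

/-- The closed form of the diagonal terms. Consecutive terms have the ratio of consecutive terms
of the Kummer series. -/
theorem gamma_series_term_eq {A u : ℂ} (b β : ℂ) (m i : ℕ) (hA : A ≠ 0) (hu : 0 < u.re) :
    (-2 * Real.pi * I) ^ (2 * i + m) * (b * conj b) ^ i * β ^ m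
        / ((i.factorial : ℂ) * ((i + m).factorial : ℂ))
        * (2 * Real.pi * (A ^ (-(u + i)) * Complex.Gamma (u + i)))
      = 2 * Real.pi * ((-2 * Real.pi * I) * β) ^ m / (m.factorial : ℂ)
        * (A ^ (-u) * Complex.Gamma u)
        * (kummerCoeff m u i * (-(4 * Real.pi ^ 2 * (b * conj b)) / A) ^ i) := by
  induction i with
  | zero => simp [kummerCoeff_zero]; ring
  | succ i ih =>
    have h1 : (u + i : ℂ) ≠ 0 := fun h => by
      have := congrArg Complex.re h
      simp at this
      linarith [(Nat.cast_nonneg i : (0 : ℝ) ≤ i)]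
    have h2 : (i + 1 : ℂ) ≠ 0 := by exact_mod_cast i.succ_ne_zero
    have h3 := one_add_add_natCast_ne_zero m i
    have h4 : (i.factorial : ℂ) ≠ 0 := by exact_mod_cast i.factorial_ne_zero
    have h5 : ((i + m).factorial : ℂ) ≠ 0 := by exact_mod_cast (i + m).factorial_ne_zero
    have h6 : A ^ (-(u + (i + 1 : ℕ))) = A ^ (-(u + i)) * A⁻¹ := by
      rw [← cpow_neg_one, ← cpow_add _ _ hA]
      push_cast; ring_nf
    have h7 : Complex.Gamma (u + (i + 1 : ℕ)) = (u + i) * Complex.Gamma (u + i) := by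
      rw [← Complex.Gamma_add_one _ h1]
      push_cast; ring_nf
    rw [h6, h7, kummerCoeff_succ, show i + 1 + m = i + m + 1 by ring, Nat.factorial_succ,
      Nat.factorial_succ, pow_succ (-(4 * Real.pi ^ 2 * (b * conj b)) / A : ℂ)]
    calc
      _ = ((u + i) / ((1 + m + i) * (i + 1)) * (-(4 * Real.pi ^ 2 * (b * conj b)) / A)) *
          ((-2 * Real.pi * I) ^ (2 * i + m) * (b * conj b) ^ i * β ^ m
          / ((i.factorial : ℂ) * ((i + m).factorial : ℂ))
          * (2 * Real.pi * (A ^ (-(u + i)) * Complex.Gamma (u + i)))) := by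
        rw [show 2 * (i + 1) + m = 2 * i + m + 2 by ring, pow_add _ (2 * i + m) 2]
        have h8 : (-2 * Real.pi * I : ℂ) ^ 2 = -(4 * Real.pi ^ 2) := by
          rw [mul_pow, I_sq]; ring
        rw [h8, pow_succ (b * conj b)]
        push_cast
        have h9 : (i + m + 1 : ℂ) ≠ 0 := by
          rw [show (i + m + 1 : ℂ) = 1 + m + i by ring]; exact h3
        rw [show (1 + m + i : ℂ) = i + m + 1 by ring]
        field_simp
      _ = _ := by rw [ih]; ring

/-- The right-hand side of the formula for the Mellin transform of `gaussReg A b`. -/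
noncomputable def gaussRegMellin (A b : ℂ) (n : ℤ) (s : ℂ) : ℂ :=
  2 * Real.pi * ((-2 * Real.pi * I) * (if 0 ≤ n then conj b else b)) ^ n.natAbs
    / (n.natAbs.factorial : ℂ)
    * (A ^ (-(s + n.natAbs / 2)) * Complex.Gamma (s + n.natAbs / 2))
    * hyp1F1 (s + n.natAbs / 2) (1 + n.natAbs) (-(4 * Real.pi ^ 2 * (b * conj b)) / A)

theorem mellinC_gaussReg {A s : ℂ} (b : ℂ) (n : ℤ) (hA : 0 < A.re) (hs : 0 < s.re) :
    mellinC (gaussReg A b) s n = gaussRegMellin A b n s := by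
  have hA0 : A ≠ 0 := fun h => by simp [h] at hA
  have h1 := hasSum_integral_gaussTerm b n hA hs
  simp_rw [integral_gaussTerm b n _ hA hs] at h1
  have hu : 0 < (s + (n.natAbs : ℂ) / 2).re := by
    have : (s + (n.natAbs : ℂ) / 2).re = s.re + (n.natAbs : ℝ) / 2 := by simp
    rw [this]; positivity
  have h2 := (hasSum_hyp1F1 n.natAbs (s + n.natAbs / 2)
    (-(4 * Real.pi ^ 2 * (b * conj b)) / A)).mul_left
    (2 * Real.pi * ((-2 * Real.pi * I) * (if 0 ≤ n then conj b else b)) ^ n.natAbs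
    / (n.natAbs.factorial : ℂ)
    * (A ^ (-(s + n.natAbs / 2)) * Complex.Gamma (s + n.natAbs / 2)))
  simp_rw [← gamma_series_term_eq b _ n.natAbs _ hA0 hu] at h2
  -- the indices `(j, k)` with `n + j = k` are parametrized by `min j k`
  rcases le_or_gt 0 n with h0 | h0
  · have hinj : Function.Injective fun i : ℕ => (i, i + n.natAbs) := fun i j h => by
      simpa using congrArg Prod.fst h
    refine ((hinj.hasSum_iff ?_).2 h1).unique (h2.congr_fun fun i => ?_)
    · rintro ⟨j, k⟩ hjk
      refine if_neg fun h => hjk ⟨j, ?_⟩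
      simp only at h
      ext <;> simp
      omega
    · rw [Function.comp_apply, if_pos (by simp only; omega), if_pos h0]
      have e : s + ((i + (i + n.natAbs) : ℕ) : ℂ) / 2 = s + (n.natAbs : ℂ) / 2 + i := by
        push_cast; ring
      simp only [e]
      generalize (-2 * Real.pi * I : ℂ) = κ
      simp only [mul_pow, pow_add, pow_mul]
      ring
  · have hinj : Function.Injective fun i : ℕ => (i + n.natAbs, i) := fun i j h => by
      simpa using congrArg Prod.snd h
    refine ((hinj.hasSum_iff ?_).2 h1).unique (h2.congr_fun fun i => ?_)
    · rintro ⟨j, k⟩ hjk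
      refine if_neg fun h => hjk ⟨k, ?_⟩
      simp only at h
      ext <;> simp
      omega
    · rw [Function.comp_apply, if_pos (by simp only; omega), if_neg (not_le.2 h0)]
      have e : s + ((i + n.natAbs + i : ℕ) : ℂ) / 2 = s + (n.natAbs : ℂ) / 2 + i := by
        push_cast; ring
      simp only [e]
      generalize (-2 * Real.pi * I : ℂ) = κ
      simp only [mul_pow, pow_add, pow_mul]
      ring

end Regularized

/-! ### Test functions and the multiplicativity of the Mellin transform -/

section TestFunctions

open Set Topology

variable {φ g : ℂ → ℂ}

theorem IsTestFunction.eventuallyEq_zero (hφ : IsTestFunction φ) : φ =ᶠ[𝓝 0] 0 :=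
  notMem_tsupport_iff_eventuallyEq.1 hφ.away

/-- The product of a test function with a function which is continuous on `ℂ^×`. -/
theorem IsTestFunction.continuous_mul (hφ : IsTestFunction φ) (hg : ContinuousOn g {0}ᶜ) :
    Continuous fun x => φ x * g x := by
  refine continuous_iff_continuousAt.2 fun x => ?_
  rcases eq_or_ne x 0 with rfl | hx
  · have : (fun x => φ x * g x) =ᶠ[𝓝 0] fun _ => 0 :=
      hφ.eventuallyEq_zero.mono fun x hx => by simp [hx]
    exact continuousAt_const.congr this.symm
  · exact hφ.smooth.continuous.continuousAt.mul
      (hg.continuousAt (isOpen_compl_singleton.mem_nhds hx))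

theorem IsTestFunction.integrable_mul (hφ : IsTestFunction φ) (hg : ContinuousOn g {0}ᶜ) :
    Integrable fun x => φ x * g x :=
  (hφ.continuous_mul hg).integrable_of_hasCompactSupport hφ.compact.mul_right

theorem continuousOn_absC_inv : ContinuousOn (fun z => (((absC z)⁻¹ : ℝ) : ℂ)) {0}ᶜ :=
  continuous_ofReal.comp_continuousOn
    (continuous_absC.continuousOn.inv₀ fun _ hz => absC_ne_zero hz)

theorem IsTestFunction.integrable_mul_mulHaarC (hφ : IsTestFunction φ)
    (hg : ContinuousOn g {0}ᶜ) : Integrable (fun x => φ x * g x) mulHaarC := by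
  rw [integrable_mulHaarC_iff]
  refine (hφ.integrable_mul (continuousOn_absC_inv.mul hg)).congr (.of_forall fun x => ?_)
  simp only [real_smul, Pi.mul_apply]; ring

theorem IsTestFunction.mul_contDiffOn (hφ : IsTestFunction φ) (hg : ContDiffOn ℝ ∞ g {0}ᶜ) :
    IsTestFunction fun x => φ x * g x where
  smooth := by
    refine contDiff_iff_contDiffAt.2 fun x => ?_
    rcases eq_or_ne x 0 with rfl | hx
    · have : (fun x => φ x * g x) =ᶠ[𝓝 0] fun _ => 0 :=
        hφ.eventuallyEq_zero.mono fun x hx => by simp [hx]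
      exact contDiffAt_const.congr_of_eventuallyEq this
    · exact hφ.smooth.contDiffAt.mul (hg.contDiffAt (isOpen_compl_singleton.mem_nhds hx))
  compact := hφ.compact.mul_right
  away h := hφ.away (closure_mono (Function.support_mul_subset_left φ g) h)

theorem continuousOn_unitChar (n : ℤ) : ContinuousOn (unitChar n) {0}ᶜ := by
  unfold unitChar
  refine ContinuousOn.zpow₀ (ContinuousOn.div continuousOn_id (by fun_prop) fun z hz => ?_) _
    fun z hz => .inl ?_
  · simpa using hz
  · exact div_ne_zero hz (by simpa using hz)

theorem continuousOn_absC_cpow (s : ℂ) : ContinuousOn (fun z => (absC z : ℂ) ^ s) {0}ᶜ :=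
  fun _ hz => (ContinuousAt.comp (f := absC) (g := fun t : ℝ => (t : ℂ) ^ s)
    (continuousAt_ofReal_cpow_const _ _ (.inr (absC_ne_zero hz)))
    continuous_absC.continuousAt).continuousWithinAt

theorem IsTestFunction.integrable_mellinIntegrand (hφ : IsTestFunction φ) (s : ℂ) (n : ℤ) :
    Integrable (mellinIntegrand φ s n) mulHaarC := by
  refine (hφ.integrable_mul_mulHaarC
    ((continuousOn_absC_cpow s).mul (continuousOn_unitChar n))).congr (.of_forall fun x => ?_)
  simp only [mellinIntegrand, Pi.mul_apply]; ring

/-- No quasicharacter is orthogonal to all test functions; this is what makes weak Mellin transforms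
unique. -/
theorem exists_isTestFunction_mellinC_ne_zero (s : ℂ) (n : ℤ) :
    ∃ φ, IsTestFunction φ ∧ mellinC φ s n ≠ 0 := by
  set g : ℂ → ℂ := fun z => (((absC z)⁻¹ : ℝ) : ℂ) * ((absC z : ℂ) ^ s * unitChar n z) with hg
  have hgc : ContinuousOn g {0}ᶜ :=
    continuousOn_absC_inv.mul ((continuousOn_absC_cpow s).mul (continuousOn_unitChar n))
  have hg1 : g 1 = 1 := by simp [hg, absC, unitChar]
  -- `φ` will be a bump function at `1` supported where the density `g` has positive real part
  have hpos : ∀ᶠ z in 𝓝 (1 : ℂ), 0 < (g z).re := by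
    have : ContinuousAt (fun z => (g z).re) 1 := continuous_re.continuousAt.comp
      (hgc.continuousAt (isOpen_compl_singleton.mem_nhds (one_ne_zero : (1 : ℂ) ≠ 0)))
    exact this.eventually (lt_mem_nhds (by simp [hg1]))
  obtain ⟨δ, hδ, hball⟩ := Metric.eventually_nhds_iff_ball.1
    (hpos.and (isOpen_compl_singleton.mem_nhds (one_ne_zero : (1 : ℂ) ≠ 0)))
  let ρ : ContDiffBump (1 : ℂ) := ⟨δ / 4, δ / 2, by positivity, by linarith⟩
  have hsub : Metric.closedBall (1 : ℂ) (δ / 2) ⊆ Metric.ball 1 δ :=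
    Metric.closedBall_subset_ball (by linarith)
  have hts : tsupport (fun z => ((ρ z : ℝ) : ℂ)) ⊆ Metric.closedBall 1 (δ / 2) := by
    have h1 : Function.support (fun z => ((ρ z : ℝ) : ℂ)) ⊆ Function.support ρ := fun z hz h =>
      hz (by simp [h])
    exact (closure_mono h1).trans ρ.tsupport_eq.le
  have hρ : IsTestFunction fun z => ((ρ z : ℝ) : ℂ) :=
    { smooth := ofRealCLM.contDiff.comp ρ.contDiff
      compact := (isCompact_closedBall (1 : ℂ) (δ / 2)).of_isClosed_subset (isClosed_tsupport _) hts
      away := fun h => (hball 0 (hsub (hts h))).2 rfl }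
  refine ⟨_, hρ, fun h0 => ?_⟩
  have h1 : mellinC (fun z => ((ρ z : ℝ) : ℂ)) s n = 2 * ∫ z, (ρ z : ℂ) * g z := by
    rw [mellinC, integral_mulHaarC, real_smul]
    congr 1
    refine integral_congr_ae (.of_forall fun z => ?_)
    simp only [mellinIntegrand, hg, real_smul]; ring
  have h2 : (∫ z, (ρ z : ℂ) * g z).re = ∫ z, ρ z * (g z).re := by
    have := integral_re (hρ.integrable_mul hgc)
    simp only [RCLike.re_to_complex, re_ofReal_mul] at this
    exact this.symm
  have h3 : 0 < ∫ z, ρ z * (g z).re := by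
    have hc : Continuous fun z => ρ z * (g z).re := by
      have := continuous_re.comp (hρ.continuous_mul hgc)
      simpa only [Function.comp_def, re_ofReal_mul] using this
    refine hc.integral_pos_of_hasCompactSupport_nonneg_nonzero ρ.hasCompactSupport.mul_right
      (fun z => ?_) (x := 1) ?_
    · by_cases hz : z ∈ Metric.ball (1 : ℂ) δ
      · exact mul_nonneg ρ.nonneg (hball z hz).1.le
      · rw [ρ.zero_of_le_dist]
        · simp
        · have : δ ≤ dist z 1 := not_lt.1 hz
          change δ / 2 ≤ dist z 1
          linarith
    · rw [hg1, ρ.one_of_mem_closedBall (Metric.mem_closedBall_self ρ.rIn_pos.le)]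
      simp
  rw [h1, mul_eq_zero] at h0
  rw [← h2, h0.resolve_left two_ne_zero] at h3
  exact lt_irrefl _ h3

theorem continuousOn_gaussReg_inv_mul (A b z : ℂ) :
    ContinuousOn (fun x => gaussReg A b (x⁻¹ * z)) {0}ᶜ :=
  (continuous_gaussReg A b).comp_continuousOn
    ((continuousOn_id.inv₀ fun _ hx => hx).mul continuousOn_const)

theorem IsTestFunction.integrable_conv (hφ : IsTestFunction φ) (A b z : ℂ) :
    Integrable (fun x => φ x * gaussReg A b (x⁻¹ * z)) mulHaarC :=
  hφ.integrable_mul_mulHaarC (continuousOn_gaussReg_inv_mul A b z)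

theorem IsTestFunction.measurable_conv_kernel (hφ : IsTestFunction φ) (A b : ℂ) :
    Measurable fun p : ℂ × ℂ => φ p.1 * gaussReg A b (p.1⁻¹ * p.2) := by
  have h1 := hφ.smooth.continuous.measurable
  have h2 := (continuous_gaussReg A b).measurable
  fun_prop

theorem IsTestFunction.measurable_mulConv (hφ : IsTestFunction φ) (A b : ℂ) :
    Measurable (mulConv φ (gaussReg A b)) := by
  have := (hφ.measurable_conv_kernel A b).stronglyMeasurable.integral_prod_left' (μ := mulHaarC)
  exact this.measurable

theorem IsTestFunction.measurable_mellinIntegrand_mulConv (hφ : IsTestFunction φ) (A b s : ℂ)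
    (n : ℤ) : Measurable (mellinIntegrand (mulConv φ (gaussReg A b)) s n) := by
  have h1 := hφ.measurable_mulConv A b
  have h2 := measurable_unitChar n
  unfold mellinIntegrand
  fun_prop

theorem mellinIntegrand_comp_inv_mul (f : ℂ → ℂ) (s : ℂ) (n : ℤ) {x : ℂ} (hx : x ≠ 0) (z : ℂ) :
    mellinIntegrand (fun z => f (x⁻¹ * z)) s n z
      = (absC x : ℂ) ^ s * unitChar n x * mellinIntegrand f s n (x⁻¹ * z) := by
  have h1 := absC_mul_cpow x (x⁻¹ * z) s
  have h2 := unitChar_mul n x (x⁻¹ * z)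
  rw [mul_inv_cancel_left₀ hx] at h1 h2
  simp only [mellinIntegrand, h1, h2]
  ring

/-- In the domain of absolute convergence the Mellin transform is multiplicative for the
convolution. -/
theorem IsTestFunction.mellinC_mulConv (hφ : IsTestFunction φ) {A s : ℂ} (b : ℂ) (n : ℤ)
    (hA : 0 < A.re) (hs : 0 < s.re) : mellinC (mulConv φ (gaussReg A b)) s n
      = mellinC φ s n * mellinC (gaussReg A b) s n := by
  set f := gaussReg A b with hf
  have hfi := integrable_mellinIntegrand_gaussReg b n hA hs
  rw [← hf] at hfi
  set H : ℂ → ℂ → ℂ := fun x z => φ x * mellinIntegrand (fun z => f (x⁻¹ * z)) s n z with hH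
  have hHx : ∀ x, x ≠ 0 → H x = fun z =>
      mellinIntegrand φ s n x * mellinIntegrand f s n (x⁻¹ * z) := fun x hx => by
    ext z
    simp only [hH, mellinIntegrand_comp_inv_mul f s n hx]
    simp only [mellinIntegrand]; ring
  have hmeas : Measurable (Function.uncurry H) := by
    have h1 := hφ.measurable_conv_kernel A b
    have h2 : Measurable fun p : ℂ × ℂ => (absC p.2 : ℂ) ^ s * unitChar n p.2 := by
      have := measurable_unitChar n
      fun_prop
    have : Function.uncurry H = fun p : ℂ × ℂ => (φ p.1 * gaussReg A b (p.1⁻¹ * p.2))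
        * ((absC p.2 : ℂ) ^ s * unitChar n p.2) := by
      ext ⟨x, z⟩
      simp only [Function.uncurry, hH, mellinIntegrand, hf]; ring
    rw [this]
    exact h1.mul h2
  have hint : Integrable (Function.uncurry H) (mulHaarC.prod mulHaarC) := by
    rw [integrable_prod_iff hmeas.aestronglyMeasurable]
    constructor
    · filter_upwards [ae_ne_zero] with x hx
      change Integrable (H x) mulHaarC
      rw [hHx x hx]
      exact ((integrable_comp_mul (inv_ne_zero hx)).2 hfi).const_mul _
    · refine ((hφ.integrable_mellinIntegrand s n).norm.mul_const
        (∫ z, ‖mellinIntegrand f s n z‖ ∂mulHaarC)).congr ?_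
      filter_upwards [ae_ne_zero] with x hx
      change _ = ∫ z, ‖H x z‖ ∂mulHaarC
      simp only [hHx x hx, norm_mul, integral_const_mul]
      rw [integral_comp_mul (inv_ne_zero hx) fun z => ‖mellinIntegrand f s n z‖]
  calc mellinC (mulConv φ f) s n = ∫ z, ∫ x, H x z ∂mulHaarC ∂mulHaarC := by
        unfold mellinC
        congr 1; ext z
        simp only [mellinIntegrand, mulConv, ← integral_mul_const, hH]
        congr 1; ext x; ring
    _ = ∫ x, ∫ z, H x z ∂mulHaarC ∂mulHaarC := (integral_integral_swap hint).symm
    _ = ∫ x, mellinIntegrand φ s n x * mellinC f s n ∂mulHaarC := by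
        refine integral_congr_ae ?_
        filter_upwards [ae_ne_zero] with x hx
        rw [hHx x hx, integral_const_mul, integral_comp_mul (inv_ne_zero hx) _]
        rfl
    _ = _ := integral_mul_const _ _

end TestFunctions

/-! ### Decay of the convolution by integration by parts -/

section Decay

open Set Topology

variable {φ h : ℂ → ℂ}

theorem IsTestFunction.integrable (hφ : IsTestFunction φ) : Integrable φ :=
  hφ.smooth.continuous.integrable_of_hasCompactSupport hφ.compact

theorem IsTestFunction.fderiv_apply_self (hφ : IsTestFunction φ) :
    IsTestFunction fun x => fderiv ℝ φ x x where
  smooth := (hφ.smooth.fderiv_right (m := ∞) (by simp)).clm_apply contDiff_id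
  compact := (hφ.compact.fderiv ℝ).mono fun x hx h => hx (by simp [h])
  away h0 := by
    have h1 : Function.support (fun x => fderiv ℝ φ x x) ⊆ Function.support (fderiv ℝ φ) :=
      fun x hx h => hx (by simp [h])
    exact hφ.away (tsupport_fderiv_subset ℝ (closure_mono h1 h0))

theorem IsTestFunction.add {ψ : ℂ → ℂ} (hφ : IsTestFunction φ) (hψ : IsTestFunction ψ) :
    IsTestFunction fun x => φ x + ψ x where
  smooth := hφ.smooth.add hψ.smooth
  compact := hφ.compact.add hψ.compact
  away := by
    rw [notMem_tsupport_iff_eventuallyEq]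
    filter_upwards [hφ.eventuallyEq_zero, hψ.eventuallyEq_zero] with x h1 h2
    simp [h1, h2]

/-- Integration by parts against a real linear form `l`, whose derivative along `v` is `l v`. -/
theorem integral_linearForm_mul_fderiv {v : ℂ} {l : ℂ →L[ℝ] ℝ} (hφ : ContDiff ℝ ∞ φ)
    (hc : HasCompactSupport φ) :
    ∫ x, (l x : ℂ) * fderiv ℝ φ x v = -∫ x, (l v : ℂ) * φ x := by
  have hl : ContDiff ℝ ∞ fun x => (l x : ℂ) := ofRealCLM.contDiff.comp l.contDiff
  have hl' : ∀ x, fderiv ℝ (fun x => (l x : ℂ)) x v = l v := fun x => by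
    have : HasFDerivAt (fun x => (l x : ℂ)) (ofRealCLM.comp l) x := (ofRealCLM.comp l).hasFDerivAt
    rw [this.fderiv]; rfl
  have hd : Continuous fun x => fderiv ℝ φ x v :=
    (hφ.continuous_fderiv (by simp)).clm_apply continuous_const
  have hdc : HasCompactSupport fun x => fderiv ℝ φ x v := hc.fderiv_apply ℝ v
  rw [integral_mul_fderiv_eq_neg_fderiv_mul_of_integrable]
  · simp_rw [hl']
  · simp_rw [hl']
    exact (continuous_const.mul hφ.continuous).integrable_of_hasCompactSupport hc.mul_left
  · exact (hl.continuous.mul hd).integrable_of_hasCompactSupport hdc.mul_left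
  · exact (hl.continuous.mul hφ.continuous).integrable_of_hasCompactSupport hc.mul_left
  · exact fun x _ => (hl.differentiable (by simp)) x
  · exact fun x _ => (hφ.differentiable (by simp)) x

/-- Integration by parts for the Euler operator `x · ∇`, whose divergence on `ℝ²` is `2`. -/
theorem IsTestFunction.integral_euler (hφ : IsTestFunction φ) :
    ∫ x, (2 * φ x + fderiv ℝ φ x x) = 0 := by
  have h1 := integral_linearForm_mul_fderiv (v := 1) (l := reCLM) hφ.smooth hφ.compact
  have h2 := integral_linearForm_mul_fderiv (v := I) (l := imCLM) hφ.smooth hφ.compact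
  simp only [reCLM_apply, imCLM_apply, one_re, I_im, ofReal_one, one_mul] at h1 h2
  have hi : ∀ (v : ℂ) (l : ℂ →L[ℝ] ℝ), Integrable fun x => (l x : ℂ) * fderiv ℝ φ x v :=
    fun v l => ((continuous_ofReal.comp l.continuous).mul ((hφ.smooth.continuous_fderiv
      (by simp)).clm_apply continuous_const)).integrable_of_hasCompactSupport
      (hφ.compact.fderiv_apply ℝ v).mul_left
  have e : ∀ x, fderiv ℝ φ x x
      = (reCLM x : ℂ) * fderiv ℝ φ x 1 + (imCLM x : ℂ) * fderiv ℝ φ x I := fun x => by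
    conv_lhs => rw [show fderiv ℝ φ x x = fderiv ℝ φ x (x.re • (1 : ℂ) + x.im • I) by
      congr 1; simp [re_add_im]]
    rw [map_add, map_smul, map_smul, real_smul, real_smul, reCLM_apply, imCLM_apply]
  simp_rw [e]
  rw [integral_add (hφ.integrable.const_mul 2) ((hi 1 reCLM).fun_add (hi I imCLM)),
    integral_add (hi 1 reCLM) (hi I imCLM), integral_const_mul]
  simp only [reCLM_apply, imCLM_apply]
  rw [h1, h2]
  ring

theorem contDiff_gaussReg (A b : ℂ) : ContDiff ℝ ∞ (gaussReg A b) := by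
  have h1 : ContDiff ℝ ∞ fun z : ℂ => (‖z‖ : ℂ) ^ 2 := by
    simp_rw [← ofReal_pow]
    exact ofRealCLM.contDiff.comp (contDiff_norm_sq ℝ)
  have h2 : ContDiff ℝ ∞ fun z : ℂ => conj (b * z) :=
    conjCLE.contDiff.comp (contDiff_const.mul contDiff_id)
  unfold gaussReg
  fun_prop

/-- The radial derivative of `gaussReg`. -/
theorem fderiv_gaussReg_apply_self (A b w : ℂ) : fderiv ℝ (gaussReg A b) w w
    = gaussReg A b w * (-(2 * A * (‖w‖ : ℂ) ^ 2)
      + -2 * Real.pi * I * (b * w) + -2 * Real.pi * I * conj (b * w)) := by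
  have h1 : HasDerivAt (fun t : ℝ => gaussReg A b (t • w)) (fderiv ℝ (gaussReg A b) w w) 1 := by
    have hd : HasFDerivAt (gaussReg A b) (fderiv ℝ (gaussReg A b) w) w :=
      ((contDiff_gaussReg A b).differentiable (by simp) w).hasFDerivAt
    have hc : HasDerivAt (fun t : ℝ => t • w) w 1 := by
      simpa using (hasDerivAt_id (1 : ℝ)).smul_const w
    exact hd.comp_hasDerivAt_of_eq 1 hc (by simp)
  have ht : HasDerivAt (fun t : ℝ => (t : ℂ)) 1 1 := (hasDerivAt_id (1 : ℝ)).ofReal_comp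
  have h2 := (((ht.fun_pow 2).const_mul (A * (‖w‖ : ℂ) ^ 2)).fun_neg.cexp).mul
    (((ht.const_mul (-2 * Real.pi * I * (b * w))).cexp).mul
      ((ht.const_mul (-2 * Real.pi * I * conj (b * w))).cexp))
  refine h1.unique ((h2.congr_of_eventuallyEq (.of_forall fun t => ?_)).congr_deriv ?_)
  · have hn : (‖t • w‖ : ℂ) ^ 2 = (‖w‖ : ℂ) ^ 2 * (t : ℂ) ^ 2 := by
      rw [norm_smul, Real.norm_eq_abs]
      norm_cast
      rw [mul_pow, sq_abs, mul_comm]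
    simp only [gaussReg, hn]
    simp only [Pi.mul_apply, real_smul, map_mul, conj_ofReal]
    ring_nf
  · simp only [gaussReg, Pi.mul_apply]
    simp
    ring

/-- The oscillatory integral `∫ h(x) gaussReg(x⁻¹ z) dx`, with respect to Lebesgue measure; for test
functions `h` it is `φ ⋆ gaussReg A b` with `φ = |x|_ℂ h / 2`. -/
noncomputable def oscInt (A b : ℂ) (h : ℂ → ℂ) (z : ℂ) : ℂ :=
  ∫ x, h x * gaussReg A b (x⁻¹ * z)

theorem contDiffOn_inv_compl : ContDiffOn ℝ ∞ (fun x : ℂ => x⁻¹) {0}ᶜ :=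
  contDiffOn_id.inv fun _ hx => hx

theorem contDiff_absC : ContDiff ℝ ∞ fun x => (absC x : ℂ) :=
  ofRealCLM.contDiff.comp (contDiff_norm_sq ℝ)

theorem IsTestFunction.integrable_oscInt (hφ : IsTestFunction φ) (A b z : ℂ) :
    Integrable fun x => φ x * gaussReg A b (x⁻¹ * z) :=
  hφ.integrable_mul (continuousOn_gaussReg_inv_mul A b z)

theorem hasFDerivAt_inv_mul {x : ℂ} (hx : x ≠ 0) (z : ℂ) : ∃ L : ℂ →L[ℝ] ℂ,
    HasFDerivAt (fun x : ℂ => x⁻¹ * z) L x ∧ L x = -(x⁻¹ * z) := by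
  have h := ((hasDerivAt_inv hx).mul_const z).hasFDerivAt.restrictScalars ℝ
  refine ⟨_, h, ?_⟩
  simp
  field_simp

/-- The Euler operator applied to a test function times the oscillating factor. -/
theorem IsTestFunction.fderiv_mul_gaussReg (hφ : IsTestFunction φ) (A b z x : ℂ) :
    fderiv ℝ (fun x => φ x * absC x * gaussReg A b (x⁻¹ * z)) x x
      = fderiv ℝ (fun x => φ x * absC x) x x * gaussReg A b (x⁻¹ * z)
        + (2 * A * (‖z‖ : ℂ) ^ 2) * (φ x * gaussReg A b (x⁻¹ * z))
        + (2 * Real.pi * I * (b * z)) * (φ x * (absC x * x⁻¹) * gaussReg A b (x⁻¹ * z))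
        + (2 * Real.pi * I * conj (b * z))
          * (φ x * (absC x * conj x⁻¹) * gaussReg A b (x⁻¹ * z)) := by
  -- at `x = 0` both sides vanish, whatever the value of `0⁻¹`
  rcases eq_or_ne x 0 with rfl | hx
  · simp [hφ.eventuallyEq_zero.eq_of_nhds]
  obtain ⟨L, hL, hLx⟩ := hasFDerivAt_inv_mul hx z
  have hk : HasFDerivAt (fun x => φ x * absC x) (fderiv ℝ (fun x => φ x * absC x) x) x :=
    ((hφ.smooth.mul contDiff_absC).differentiable (by simp) x).hasFDerivAt
  have hg : HasFDerivAt (gaussReg A b) (fderiv ℝ (gaussReg A b) (x⁻¹ * z)) (x⁻¹ * z) :=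
    ((contDiff_gaussReg A b).differentiable (by simp) _).hasFDerivAt
  have hH := hk.mul (hg.comp x hL)
  have hfd : fderiv ℝ (fun x => φ x * absC x * gaussReg A b (x⁻¹ * z)) x = _ := hH.fderiv
  have hn : (absC x : ℂ) * (‖x⁻¹ * z‖ : ℂ) ^ 2 = (‖z‖ : ℂ) ^ 2 := by
    have : (‖x‖ : ℂ) ≠ 0 := by simpa using hx
    simp only [absC, norm_mul, norm_inv]
    push_cast
    field_simp
  rw [hfd]
  simp only [add_apply, smul_apply,
    ContinuousLinearMap.comp_apply, hLx, map_neg, fderiv_gaussReg_apply_self, smul_eq_mul,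
    Function.comp_apply]
  rw [← hn]
  simp only [map_mul]
  ring

/-- The recursion behind the decay estimate: `|z|²` times an oscillatory integral is a combination
of oscillatory integrals with coefficients of degree at most one in `z`. -/
theorem IsTestFunction.oscInt_recursion (hφ : IsTestFunction φ) : ∃ φ₁ φ₂ φ₃ : ℂ → ℂ,
    IsTestFunction φ₁ ∧ IsTestFunction φ₂ ∧ IsTestFunction φ₃ ∧ ∀ A b z,
      2 * A * (‖z‖ : ℂ) ^ 2 * oscInt A b φ z = -(oscInt A b φ₁ z
        + 2 * Real.pi * I * (b * z) * oscInt A b φ₂ z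
        + 2 * Real.pi * I * conj (b * z) * oscInt A b φ₃ z) := by
  have hk : IsTestFunction fun x => φ x * absC x := hφ.mul_contDiffOn contDiff_absC.contDiffOn
  have hconj : ContDiffOn ℝ ∞ (fun x : ℂ => conj x⁻¹) {0}ᶜ :=
    conjCLE.contDiff.comp_contDiffOn contDiffOn_inv_compl
  have h1 : IsTestFunction fun x => 2 * (φ x * absC x) + fderiv ℝ (fun x => φ x * absC x) x x := by
    have h2k : IsTestFunction fun x => 2 * (φ x * absC x) := by
      have := hk.mul_contDiffOn (g := fun _ => 2) contDiffOn_const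
      simpa only [mul_comm _ (2 : ℂ)] using this
    exact h2k.add hk.fderiv_apply_self
  have h2 : IsTestFunction fun x => φ x * (absC x * x⁻¹) :=
    hφ.mul_contDiffOn (contDiff_absC.contDiffOn.mul contDiffOn_inv_compl)
  have h3 : IsTestFunction fun x => φ x * (absC x * conj x⁻¹) :=
    hφ.mul_contDiffOn (contDiff_absC.contDiffOn.mul hconj)
  refine ⟨_, _, _, h1, h2, h3, fun A b z => ?_⟩
  have hH : IsTestFunction fun x => φ x * absC x * gaussReg A b (x⁻¹ * z) :=
    hk.mul_contDiffOn ((contDiff_gaussReg A b).comp_contDiffOn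
      (contDiffOn_inv_compl.mul contDiffOn_const))
  -- the Euler operator is applied to `φ |x|_ℂ`, as the factor `|x|_ℂ` cancels the `|x|⁻²` coming
  -- from the derivative of the Gaussian
  have key := hH.integral_euler
  simp only [hφ.fderiv_mul_gaussReg] at key
  have e : ∀ x, 2 * (φ x * absC x * gaussReg A b (x⁻¹ * z))
      + (fderiv ℝ (fun x => φ x * absC x) x x * gaussReg A b (x⁻¹ * z)
        + (2 * A * (‖z‖ : ℂ) ^ 2) * (φ x * gaussReg A b (x⁻¹ * z))
        + (2 * Real.pi * I * (b * z)) * (φ x * (absC x * x⁻¹) * gaussReg A b (x⁻¹ * z))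
        + (2 * Real.pi * I * conj (b * z))
          * (φ x * (absC x * conj x⁻¹) * gaussReg A b (x⁻¹ * z)))
      = (2 * (φ x * absC x) + fderiv ℝ (fun x => φ x * absC x) x x) * gaussReg A b (x⁻¹ * z)
        + (2 * A * (‖z‖ : ℂ) ^ 2) * (φ x * gaussReg A b (x⁻¹ * z))
        + (2 * Real.pi * I * (b * z)) * (φ x * (absC x * x⁻¹) * gaussReg A b (x⁻¹ * z))
        + (2 * Real.pi * I * conj (b * z))
          * (φ x * (absC x * conj x⁻¹) * gaussReg A b (x⁻¹ * z)) := fun x => by ring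
  simp_rw [e] at key
  have i0 := (hφ.integrable_oscInt A b z).const_mul (2 * A * (‖z‖ : ℂ) ^ 2)
  have i1 := h1.integrable_oscInt A b z
  have i2 := (h2.integrable_oscInt A b z).const_mul (2 * Real.pi * I * (b * z))
  have i3 := (h3.integrable_oscInt A b z).const_mul (2 * Real.pi * I * conj (b * z))
  rw [integral_add ((i1.fun_add i0).fun_add i2) i3, integral_add (i1.fun_add i0) i2,
    integral_add i1 i0,
    integral_const_mul, integral_const_mul, integral_const_mul] at key
  unfold oscInt
  linear_combination key

theorem norm_gaussReg_le_one {A : ℂ} (hA : 0 ≤ A.re) (b z : ℂ) : ‖gaussReg A b z‖ ≤ 1 := by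
  rw [norm_gaussReg, Real.exp_le_one_iff]
  have : 0 ≤ A.re * ‖z‖ ^ 2 := by positivity
  linarith

theorem IsTestFunction.norm_oscInt_le (hφ : IsTestFunction φ) {A : ℂ} (hA : 0 ≤ A.re) (b z : ℂ) :
    ‖oscInt A b φ z‖ ≤ ∫ x, ‖φ x‖ := by
  refine norm_integral_le_of_norm_le hφ.integrable.norm (.of_forall fun x => ?_)
  rw [norm_mul]
  exact mul_le_of_le_one_right (norm_nonneg _) (norm_gaussReg_le_one hA b _)

/-- The oscillatory integrals decay rapidly at infinity, uniformly in `A` away from `0`. -/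
theorem IsTestFunction.exists_oscInt_bound {c : ℝ} (hc : 0 < c) (b : ℂ) (k : ℕ) :
    ∀ {φ : ℂ → ℂ}, IsTestFunction φ → ∃ C : ℝ, ∀ A : ℂ, 0 ≤ A.re → c ≤ ‖A‖ → ∀ z : ℂ,
      ‖z‖ ^ k * ‖oscInt A b φ z‖ ≤ C := by
  induction k with
  | zero => exact fun hφ => ⟨_, fun A hA _ z => by simpa using hφ.norm_oscInt_le hA b z⟩
  | succ k ih =>
    intro φ hφ
    obtain ⟨φ₁, φ₂, φ₃, h1, h2, h3, hrec⟩ := hφ.oscInt_recursion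
    obtain ⟨C₁, hC₁⟩ := ih h1
    obtain ⟨C₂, hC₂⟩ := ih h2
    obtain ⟨C₃, hC₃⟩ := ih h3
    refine ⟨max (∫ x, ‖φ x‖) ((C₁ + 2 * Real.pi * ‖b‖ * C₂ + 2 * Real.pi * ‖b‖ * C₃) / (2 * c)),
      fun A hA hcA z => ?_⟩
    have h0 := hφ.norm_oscInt_le hA b z
    -- the recursion is used for `1 ≤ ‖z‖` only, where it may be divided by `‖z‖`
    rcases le_total ‖z‖ 1 with hz | hz
    · refine le_trans ?_ (le_max_left _ _)
      exact (mul_le_of_le_one_left (norm_nonneg _) (pow_le_one₀ (norm_nonneg z) hz)).trans h0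
    · refine le_trans ?_ (le_max_right _ _)
      rw [le_div_iff₀ (by positivity)]
      have hz0 : 0 < ‖z‖ := by linarith
      have hn := congrArg norm (hrec A b z)
      have hπ : ∀ w : ℂ, ‖2 * Real.pi * I * w‖ = 2 * Real.pi * ‖w‖ := fun w => by
        simp [abs_of_pos Real.pi_pos]
      have hle : 2 * ‖A‖ * ‖z‖ ^ 2 * ‖oscInt A b φ z‖ ≤ ‖oscInt A b φ₁ z‖
          + 2 * Real.pi * (‖b‖ * ‖z‖) * ‖oscInt A b φ₂ z‖
          + 2 * Real.pi * (‖b‖ * ‖z‖) * ‖oscInt A b φ₃ z‖ := by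
        have hl : 2 * ‖A‖ * ‖z‖ ^ 2 * ‖oscInt A b φ z‖
            = ‖2 * A * (‖z‖ : ℂ) ^ 2 * oscInt A b φ z‖ := by simp
        rw [hl, hn, norm_neg]
        refine (norm_add₃_le ..).trans_eq ?_
        rw [norm_mul, norm_mul _ (oscInt A b φ₃ z), hπ, hπ, RCLike.norm_conj, norm_mul]
      have hC₁' : ‖z‖ ^ k * ‖oscInt A b φ₁ z‖ ≤ C₁ * ‖z‖ :=
        (hC₁ A hA hcA z).trans (le_mul_of_one_le_right
          ((by positivity : 0 ≤ ‖z‖ ^ k * ‖oscInt A b φ₁ z‖).trans (hC₁ A hA hcA z)) hz)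
      have hb : 0 ≤ 2 * Real.pi * ‖b‖ := by positivity
      refine le_of_mul_le_mul_right ?_ hz0
      calc ‖z‖ ^ (k + 1) * ‖oscInt A b φ z‖ * (2 * c) * ‖z‖
          = ‖z‖ ^ k * (2 * c * ‖z‖ ^ 2 * ‖oscInt A b φ z‖) := by ring
        _ ≤ ‖z‖ ^ k * (2 * ‖A‖ * ‖z‖ ^ 2 * ‖oscInt A b φ z‖) := by gcongr
        _ ≤ ‖z‖ ^ k * (‖oscInt A b φ₁ z‖
          + 2 * Real.pi * (‖b‖ * ‖z‖) * ‖oscInt A b φ₂ z‖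
          + 2 * Real.pi * (‖b‖ * ‖z‖) * ‖oscInt A b φ₃ z‖) := by gcongr
        _ = ‖z‖ ^ k * ‖oscInt A b φ₁ z‖
          + 2 * Real.pi * ‖b‖ * (‖z‖ ^ k * ‖oscInt A b φ₂ z‖) * ‖z‖
          + 2 * Real.pi * ‖b‖ * (‖z‖ ^ k * ‖oscInt A b φ₃ z‖) * ‖z‖ := by ring
        _ ≤ C₁ * ‖z‖ + 2 * Real.pi * ‖b‖ * C₂ * ‖z‖ + 2 * Real.pi * ‖b‖ * C₃ * ‖z‖ := by
          gcongr
          · exact hC₂ A hA hcA z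
          · exact hC₃ A hA hcA z
        _ = _ := by ring

end Decay

/-! ### Removing the regularization -/

section Limit

open Set Topology Filter

variable {φ : ℂ → ℂ} {a : ℝ}

theorem mulConv_gaussReg_eq_oscInt (φ : ℂ → ℂ) (A b z : ℂ) :
    mulConv φ (gaussReg A b) z
      = oscInt A b (fun x => φ x * (2 * (((absC x)⁻¹ : ℝ) : ℂ))) z := by
  rw [mulConv, integral_mulHaarC, oscInt, ← integral_smul]
  refine integral_congr_ae (.of_forall fun x => ?_)
  simp only [real_smul]
  push_cast
  ring

theorem IsTestFunction.mul_two_absC_inv (hφ : IsTestFunction φ) :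
    IsTestFunction fun x => φ x * (2 * (((absC x)⁻¹ : ℝ) : ℂ)) := by
  refine hφ.mul_contDiffOn (contDiffOn_const.mul ?_)
  exact ofRealCLM.contDiff.comp_contDiffOn ((contDiff_norm_sq ℝ).contDiffOn.inv
    fun x hx => absC_ne_zero hx)

/-- The first condition on the exponents gives convergence at `0`, the second one at infinity. -/
theorem integrable_rpow_div_one_add_pow {σ : ℝ} {k : ℕ} (hσ : 0 < σ) (hk : 2 * σ < k) :
    Integrable (fun z : ℂ => ‖z‖ ^ (2 * σ) / (1 + ‖z‖ ^ k)) mulHaarC := by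
  rw [integrable_mulHaarC_norm (g := fun r => r ^ (2 * σ) / (1 + r ^ k)),
    ← Ioc_union_Ioi_eq_Ioi zero_le_one]
  have hmeas : Measurable fun r : ℝ => r⁻¹ • (r ^ (2 * σ) / (1 + r ^ k)) := by fun_prop
  have h0 : ∀ r : ℝ, 0 < r → ‖r⁻¹ • (r ^ (2 * σ) / (1 + r ^ k))‖
      = r ^ (2 * σ - 1) / (1 + r ^ k) := fun r hr => by
    rw [smul_eq_mul, Real.norm_of_nonneg (by positivity), Real.rpow_sub_one hr.ne']
    ring
  refine IntegrableOn.union ?_ ?_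
  · have h1 : IntegrableOn (fun r : ℝ => r ^ (2 * σ - 1)) (Ioc 0 1) :=
      (intervalIntegrable_iff_integrableOn_Ioc_of_le zero_le_one).1
        (intervalIntegral.intervalIntegrable_rpow' (by linarith))
    refine h1.mono' hmeas.aestronglyMeasurable ?_
    filter_upwards [ae_restrict_mem measurableSet_Ioc] with r hr
    have hr0 : 0 < r := hr.1
    rw [h0 r hr0]
    exact div_le_self (by positivity) (by linarith [pow_pos hr0 k])
  · have h1 : IntegrableOn (fun r : ℝ => r ^ (2 * σ - 1 - k)) (Ioi 1) :=
      integrableOn_Ioi_rpow_of_lt (by linarith) one_pos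
    refine h1.mono' hmeas.aestronglyMeasurable ?_
    filter_upwards [ae_restrict_mem measurableSet_Ioi] with r (hr : 1 < r)
    have hr0 : 0 < r := by linarith
    rw [h0 r hr0, Real.rpow_sub hr0 _ (k : ℝ), Real.rpow_natCast]
    gcongr
    linarith

/-- A dominating function, obtained from the decay of order `k > 2 Re s`, for the Mellin
integrands of `φ ⋆ gaussReg A b`, uniform in `A`. -/
theorem IsTestFunction.exists_mellinIntegrand_bound (hφ : IsTestFunction φ) {c : ℝ} (hc : 0 < c)
    (b : ℂ) {s : ℂ} (hs : 0 < s.re) (n : ℤ) : ∃ B : ℂ → ℝ, Integrable B mulHaarC ∧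
      ∀ A : ℂ, 0 ≤ A.re → c ≤ ‖A‖ → ∀ z : ℂ, z ≠ 0 →
        ‖mellinIntegrand (mulConv φ (gaussReg A b)) s n z‖ ≤ B z := by
  obtain ⟨k, hk⟩ := exists_nat_gt (2 * s.re)
  obtain ⟨C₀, hC₀⟩ := exists_oscInt_bound hc b 0 hφ.mul_two_absC_inv
  obtain ⟨C₁, hC₁⟩ := exists_oscInt_bound hc b k hφ.mul_two_absC_inv
  refine ⟨fun z => (C₀ + C₁) * (‖z‖ ^ (2 * s.re) / (1 + ‖z‖ ^ k)),
    (integrable_rpow_div_one_add_pow hs hk).const_mul _, fun A hA hcA z hz => ?_⟩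
  simp only
  rw [norm_mellinIntegrand _ _ _ hz, mulConv_gaussReg_eq_oscInt, mul_div_assoc', le_div_iff₀
    (by positivity), mul_right_comm]
  gcongr
  have h0 := hC₀ A hA hcA z
  have h1 := hC₁ A hA hcA z
  rw [pow_zero, one_mul] at h0
  linarith

theorem tendsto_mulConv_gaussReg (hφ : IsTestFunction φ) (b z : ℂ) {A : ℕ → ℂ} {A₀ : ℂ}
    (hA : ∀ j, 0 ≤ (A j).re) (hlim : Tendsto A atTop (𝓝 A₀)) :
    Tendsto (fun j => mulConv φ (gaussReg (A j) b) z) atTop (𝓝 (mulConv φ (gaussReg A₀ b) z)) := by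
  have hφi : Integrable φ mulHaarC := by
    simpa using hφ.integrable_mul_mulHaarC (g := fun _ => 1) continuousOn_const
  refine tendsto_integral_of_dominated_convergence (fun x => ‖φ x‖)
    (fun j => (hφ.integrable_conv (A j) b z).aestronglyMeasurable) hφi.norm
    (fun j => .of_forall fun x => ?_) (.of_forall fun x => ?_)
  · rw [norm_mul]
    exact mul_le_of_le_one_right (norm_nonneg _) (norm_gaussReg_le_one (hA j) b _)
  · have hcont : Continuous fun A => gaussReg A b (x⁻¹ * z) := by
      unfold gaussReg; fun_prop
    exact ((hcont.tendsto A₀).comp hlim).const_mul _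

theorem tendsto_gaussRegMellin (b : ℂ) (n : ℤ) (s : ℂ) {A : ℕ → ℂ} {A₀ : ℂ}
    (hA₀ : A₀ ∈ slitPlane) (hlim : Tendsto A atTop (𝓝 A₀)) :
    Tendsto (fun j => gaussRegMellin (A j) b n s) atTop (𝓝 (gaussRegMellin A₀ b n s)) := by
  have h0 : A₀ ≠ 0 := slitPlane_ne_zero hA₀
  have h1 : ContinuousAt (fun A : ℂ => A ^ (-(s + n.natAbs / 2))) A₀ :=
    continuousAt_id.cpow continuousAt_const hA₀
  have h2 : ContinuousAt (fun A : ℂ => hyp1F1 (s + n.natAbs / 2) (1 + n.natAbs)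
      (-(4 * Real.pi ^ 2 * (b * conj b)) / A)) A₀ :=
    (continuous_hyp1F1 n.natAbs _).continuousAt.comp (continuousAt_const.div continuousAt_id h0)
  have h3 : ContinuousAt (fun A => gaussRegMellin A b n s) A₀ := by
    unfold gaussRegMellin
    exact (continuousAt_const.mul (h1.mul continuousAt_const)).mul h2
  exact h3.tendsto.comp hlim

theorem sqrt_eq_exp_half_log {x : ℝ} (hx : 0 < x) : Real.sqrt x = Real.exp (Real.log x / 2) := by
  rw [Real.sqrt_eq_rpow, Real.rpow_def_of_pos hx]
  ring_nf

/-- At the boundary point `A = 2πi a` the formula for the regularized character becomes the formula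
for `gaussChar a b`; here `(2πi a) ^ w` is the principal branch, with `arg i = π / 2`. -/
theorem gaussRegMellin_two_pi_I_mul (ha : 0 < a) (b : ℂ) (n : ℤ) (s : ℂ) :
    gaussRegMellin (2 * Real.pi * I * a) b n s = zValue a b n s := by
  set β : ℂ := if 0 ≤ n then conj b else b with hβ
  set m := n.natAbs with hm
  have haC : (a : ℂ) ≠ 0 := ofReal_ne_zero.2 ha.ne'
  have hπ : (Real.pi : ℂ) ≠ 0 := ofReal_ne_zero.2 Real.pi_ne_zero
  have hp : (0 : ℝ) < 2 * Real.pi := by positivity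
  have hbβ : b * conj b = (‖β‖ : ℂ) ^ 2 := by
    rw [mul_conj', hβ]
    split_ifs <;> simp
  have harg : -(4 * Real.pi ^ 2 * (b * conj b)) / (2 * Real.pi * I * a)
      = 2 * Real.pi * I * (‖β‖ : ℂ) ^ 2 / a := by
    rw [hbβ]
    field_simp
    rw [I_sq]; ring
  -- all powers are exponentials of combinations of `log (2π)`, `log a` and `π i / 2`
  set L₁ : ℂ := ((Real.log (2 * Real.pi) : ℝ) : ℂ) with hL₁
  set L₂ : ℂ := ((Real.log a : ℝ) : ℂ) with hL₂
  have e1 : ((2 * Real.pi : ℝ) : ℂ) = Complex.exp L₁ := by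
    rw [hL₁, ← ofReal_exp, Real.exp_log hp]
  have eI : I = Complex.exp (Real.pi * I / 2) := by
    rw [show (Real.pi * I / 2 : ℂ) = Real.pi / 2 * I by ring, exp_pi_div_two_mul_I]
  have c1 : ∀ w : ℂ, ((2 * Real.pi : ℝ) : ℂ) ^ w = Complex.exp (L₁ * w) := fun w => by
    rw [cpow_def_of_ne_zero (ofReal_ne_zero.2 hp.ne'), ← ofReal_log hp.le]
  have c2 : ∀ w : ℂ, (a : ℂ) ^ w = Complex.exp (L₂ * w) := fun w => by
    rw [cpow_def_of_ne_zero haC, ← ofReal_log ha.le]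
  have cA : ∀ w : ℂ, (2 * Real.pi * I * a : ℂ) ^ w
      = Complex.exp ((L₁ + L₂ + Real.pi * I / 2) * w) := fun w => by
    have h0 : (2 * Real.pi * I * a : ℂ) = ((2 * Real.pi * a : ℝ) : ℂ) * I := by push_cast; ring
    rw [h0, cpow_def_of_ne_zero (mul_ne_zero (ofReal_ne_zero.2 (by positivity)) I_ne_zero),
      log_ofReal_mul (by positivity) I_ne_zero, Real.log_mul hp.ne' ha.ne', log_I, ofReal_add,
      ← hL₁, ← hL₂]
    congr 1
    ring
  have e3 : ((Real.sqrt (2 * Real.pi) / Real.sqrt a : ℝ) : ℂ)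
      = Complex.exp ((L₁ - L₂) / 2) := by
    rw [sqrt_eq_exp_half_log hp, sqrt_eq_exp_half_log ha, ← Real.exp_sub, ofReal_exp,
      ofReal_sub, ofReal_div, ofReal_div, ← hL₁, ← hL₂, ofReal_ofNat, sub_div]
  have e4 : (-2 * Real.pi * I : ℂ) = -1 * Complex.exp (L₁ + Real.pi * I / 2) := by
    rw [Complex.exp_add, ← e1, ← eI]
    push_cast; ring
  have key : (2 * Real.pi : ℂ) * Complex.exp (L₁ + Real.pi * I / 2) ^ m
      * (2 * Real.pi * I * a : ℂ) ^ (-(s + m / 2))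
      = Complex.exp (-(Real.pi * I / 2) * (s - m / 2)) / (a : ℂ) ^ s
        / ((2 * Real.pi : ℝ) : ℂ) ^ (s - 1) * Complex.exp ((L₁ - L₂) / 2) ^ m := by
    rw [show (2 * Real.pi : ℂ) = Complex.exp L₁ by rw [← e1]; push_cast; ring] at cA ⊢
    rw [cA, c1, c2, ← Complex.exp_nat_mul, ← Complex.exp_nat_mul, ← Complex.exp_sub,
      ← Complex.exp_sub, ← Complex.exp_add, ← Complex.exp_add, ← Complex.exp_add]
    congr 1
    ring
  unfold gaussRegMellin zValue zExpr
  rw [← hβ, ← hm, harg, e3, e4, mul_pow, mul_pow, mul_pow]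
  linear_combination ((-1) ^ m * β ^ m / (m.factorial : ℂ) * Complex.Gamma (s + m / 2)
    * hyp1F1 (s + m / 2) (1 + m) (2 * Real.pi * I * (‖β‖ : ℂ) ^ 2 / a)) * key

/-- The regularization is removed: the Mellin transforms of `φ ⋆ gaussReg A b` converge as
`A → 2πi a` within the right half plane, by dominated convergence. -/
theorem isWeakMellin_zValue (ha : 0 < a) (b : ℂ) (n : ℤ) {s : ℂ} (hs : 0 < s.re) :
    IsWeakMellin (gaussChar a b) s n (zValue a b n s) := by
  intro φ hφ
  rw [funext (gaussChar_eq_gaussReg a b)]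
  set A₀ : ℂ := 2 * Real.pi * I * a with hA₀
  have hA₀im : A₀.im = 2 * Real.pi * a := by simp [hA₀]
  have hA₀re : A₀.re = 0 := by simp [hA₀]
  set A : ℕ → ℂ := fun j => A₀ + ((1 / ((j : ℝ) + 1) : ℝ) : ℂ) with hA
  have hAre : ∀ j, 0 < (A j).re := fun j => by
    simp only [hA, add_re, hA₀re, ofReal_re, zero_add]
    positivity
  have hc : 0 < 2 * Real.pi * a := by positivity
  have hAn : ∀ j, 2 * Real.pi * a ≤ ‖A j‖ := fun j => by
    have h := (le_abs_self _).trans (abs_im_le_norm (A j))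
    simpa only [hA, add_im, ofReal_im, add_zero, hA₀im] using h
  have hA₀n : 2 * Real.pi * a ≤ ‖A₀‖ := hA₀im ▸ (le_abs_self _).trans (abs_im_le_norm A₀)
  have hlim : Tendsto A atTop (𝓝 A₀) := by
    have h1 : Tendsto (fun j : ℕ => ((1 / ((j : ℝ) + 1) : ℝ) : ℂ)) atTop (𝓝 ((0 : ℝ) : ℂ)) :=
      (continuous_ofReal.tendsto 0).comp tendsto_one_div_add_atTop_nhds_zero_nat
    simpa only [ofReal_zero, add_zero] using h1.const_add A₀
  obtain ⟨B, hB, hbound⟩ := hφ.exists_mellinIntegrand_bound hc b hs n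
  have hmeas := fun A => (hφ.measurable_mellinIntegrand_mulConv A b s n).aestronglyMeasurable
    (μ := mulHaarC)
  refine ⟨fun z _ => hφ.integrable_conv A₀ b z, hB.mono' (hmeas A₀) ?_, ?_⟩
  · filter_upwards [ae_ne_zero] with z hz using hbound A₀ hA₀re.ge hA₀n z hz
  have h1 : Tendsto (fun j => mellinC (mulConv φ (gaussReg (A j) b)) s n) atTop
      (𝓝 (mellinC (mulConv φ (gaussReg A₀ b)) s n)) := by
    refine tendsto_integral_of_dominated_convergence B (fun j => hmeas (A j)) hB (fun j => ?_)
      (.of_forall fun z => ?_)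
    · filter_upwards [ae_ne_zero] with z hz using hbound (A j) (hAre j).le (hAn j) z hz
    · exact ((tendsto_mulConv_gaussReg hφ b z (fun j => (hAre j).le) hlim).mul_const _).mul_const _
  have h2 : Tendsto (fun j => mellinC φ s n * gaussRegMellin (A j) b n s) atTop
      (𝓝 (mellinC φ s n * gaussRegMellin A₀ b n s)) :=
    (tendsto_gaussRegMellin b n s (.inr (by rw [hA₀im]; exact hc.ne')) hlim).const_mul _
  have h3 : ∀ j, mellinC (mulConv φ (gaussReg (A j) b)) s n
      = mellinC φ s n * gaussRegMellin (A j) b n s := fun j => by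
    rw [hφ.mellinC_mulConv b n (hAre j) hs, mellinC_gaussReg b n (hAre j) hs]
  simp_rw [h3] at h1
  rw [tendsto_nhds_unique h1 h2, gaussRegMellin_two_pi_I_mul ha, mul_comm]

theorem isWeakMellin_unique {f : ℂ → ℂ} {s : ℂ} {n : ℤ} {M N : ℂ} (hM : IsWeakMellin f s n M)
    (hN : IsWeakMellin f s n N) : M = N := by
  obtain ⟨φ, hφ, h0⟩ := exists_isTestFunction_mellinC_ne_zero s n
  exact mul_right_cancel₀ h0 ((hM φ hφ).2.2.symm.trans (hN φ hφ).2.2)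

theorem isWeakMellin_gaussChar_iff (ha : 0 < a) (b : ℂ) (n : ℤ) {s M : ℂ} (hs : 0 < s.re) :
    IsWeakMellin (gaussChar a b) s n M ↔ M = zValue a b n s :=
  ⟨fun hM => isWeakMellin_unique hM (isWeakMellin_zValue ha b n hs),
    fun hM => hM ▸ isWeakMellin_zValue ha b n hs⟩

end Limit

end WeakMellin

theorem mainTheorem12 (a : ℝ) (ha : 0 < a) (b : ℂ) (n : ℤ) :
    -- for `Re s > 0`, the weak Mellin transform exists, is unique, and is given by the formula
    (∀ s : ℂ, 0 < s.re → ∀ M : ℂ,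
      WeakMellin.IsWeakMellin (WeakMellin.gaussChar a b) s n M ↔ M = WeakMellin.zValue a b n s) ∧
    -- the formula gives its meromorphic continuation to the whole plane
    (∀ s : ℂ, MeromorphicAt (WeakMellin.zValue a b n) s) ∧
    -- all the zeros lie on the critical line
    (n = 0 ∨ b ≠ 0 →
      (∀ s : ℂ, 0 < s.re →
        WeakMellin.IsWeakMellin (WeakMellin.gaussChar a b) s n 0 → s.re = 1 / 2) ∧
      (∀ s : ℂ, 0 < meromorphicOrderAt (WeakMellin.zValue a b n) s → s.re = 1 / 2)) := by
  have hiff := fun (s : ℂ) (hs : 0 < s.re) (M : ℂ) =>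
    WeakMellin.isWeakMellin_gaussChar_iff (M := M) ha b n hs
  refine ⟨hiff, fun s => WeakMellin.meromorphicAt_zExpr ha s, fun hnb => ?_⟩
  have hβ : n.natAbs = 0 ∨ (if 0 ≤ n then conj b else b) ≠ 0 := by
    refine hnb.imp Int.natAbs_eq_zero.2 fun hb => ?_
    split_ifs
    · simpa using hb
    · exact hb
  exact ⟨fun s hs h0 => WeakMellin.re_eq_half_of_zExpr_eq_zero ha hβ hs ((hiff s hs 0).1 h0).symm,
    fun s hs => WeakMellin.re_eq_half_of_meromorphicOrderAt_zExpr_pos ha hβ hs⟩
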